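/- **Setting.** Formulas are those of multiplicative linear logic, $A,B ::= X^+ \mid X^- \mid 1 \mid \bot \mid A\otimes B \mid A⅋B$, with the usual negation $(\cdot)^\perp$. A *typed graph* is a finite partial graph (pending edges allowed) with edges labelled by formulas and nodes labelled by rules. The edges at a node are its premises and its conclusions, typed as follows: $\mathsf{ax}$ (conclusions $X^+,X^-$), $\mathsf{cut}$ (premises $A,A^\perp$), $\otimes$ (premises $A,B$, conclusion $A\otimes B$), $⅋$ (premises $A,B$, conclusion $A⅋B$), $1$ (conclusion $1$), $\bot$ (conclusion $\bot$), weakening (conclusion $X^-$), contraction (at least two premises $X^-$, conclusion $X^-$), $\mathsf{box}$ (conclusions $Y_1^-,\dots,Y_k^-,X^+$ with $k\ge 0$ and $X\ne Y_i$ for all $i$). An edge is the conclusion of at most one node and the premise of at most one node. A *proof-net* is a typed graph in which every edge is the conclusion of some node and every (undirected) cycle uses two premises of a same $⅋$-node or of a same contraction node; its conclusions are the edges that are premise of no node. A *sub-net* of a proof-net is a subgraph that is itself a proof-net. We write $R=\mathrm{Cut}(R_1,\dots,R_n)$ for a proof-net $R$ given with a partition into sub-nets $R_1,\dots,R_n$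 and $\mathsf{cut}$-nodes, the two premises of each of these $\mathsf{cut}$-nodes being conclusions of two distinct sub-nets. It is a *cut-net* if its skeleton, the graph with vertices $R_1,\dots,R_n$ and an edge between $R_i$ and $R_j$ ($i\neq j$) exactly when there is at least one such $\mathsf{cut}$-node between $R_i$ and $R_j$, is a tree. The $\otimes/⅋$-reduction step replaces a $\mathsf{cut}$ between the conclusion of a $\otimes$-node with premises $a,b$ and the conclusion of a $⅋$-node with premises $a',b'$ by two $\mathsf{cut}$-nodes, one on $a,a'$ and one on $b,b'$ (the $\otimes$-node, the $⅋$-node and their conclusions are removed). If a proof-net $R'$ reduces to a proof-net $R$ in one such step, $R'$ is a $\otimes/⅋$-*expansion* of $R$. If $R=\mathrm{Cut}(R_1,\dots,R_n)$, an expansion *on the cuts between $R_i$ and $R_j$* is one in which the two $\mathsf{cut}$-nodes it replaces are both between $R_i$ and $R_j$; the new $\otimes$-node is added to one of $R_i,R_j$ and the new $⅋$-node to the other, and the other sub-nets are unchanged. **Theorem.** Given a cut-net $R=\mathrm{Cut}(R_1,\dots,R_n)$, there is a (finite, possibly empty) sequence of $\otimes/⅋$-expansions, each on the cuts between some pair of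 sub-nets, such that the result is a cut-net $R'=\mathrm{Cut}(R_1',\dots,R_n')$ with at most one cut between each pair $(R_i',R_j')$, $i\neq j$. -/

import Mathlib

/-- Formulas of multiplicative linear logic over a set `α` of symbols. -/
inductive MLLFormula (α : Type*) where
  | pos (X : α)
  | neg (X : α)
  | one
  | bot
  | tensor (A B : MLLFormula α)
  | par (A B : MLLFormula α)

/-- Linear negation. -/
def MLLFormula.dual {α : Type*} : MLLFormula α → MLLFormula α
  | .pos X => .neg X
  | .neg X => .pos X
  | .one => .bot
  | .bot => .one
  | .tensor A B => .par A.dual B.dual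
  | .par A B => .tensor A.dual B.dual

/-- The rules that label the nodes of a net. -/
inductive NodeLabel where
  | ax
  | cut
  | tensor
  | par
  | one
  | bot
  | weak
  | contr
  | box

/-- `NodeLabel.Typing r Γ Δ`: a node labelled `r` may have premises of types `Γ` and conclusions of
types `Δ` (each listed from left to right). -/
inductive NodeLabel.Typing {α : Type*} :
    NodeLabel → List (MLLFormula α) → List (MLLFormula α) → Prop
  | ax (X : α) : Typing .ax [] [.pos X, .neg X]
  | cut (A : MLLFormula α) : Typing .cut [A, A.dual] []
  | tensor (A B : MLLFormula α) : Typing .tensor [A, B] [.tensor A B]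
  | par (A B : MLLFormula α) : Typing .par [A, B] [.par A B]
  | one : Typing .one [] [.one]
  | bot : Typing .bot [] [.bot]
  | weak (X : α) : Typing .weak [] [.neg X]
  | contr (X : α) (k : ℕ) (hk : 2 ≤ k) : Typing .contr (List.replicate k (.neg X)) [.neg X]
  | box (X : α) (Ys : List α) (h : X ∉ Ys) :
      Typing .box [] (Ys.map MLLFormula.neg ++ [MLLFormula.pos X])

/-- A finite partial graph with labelled nodes and edges; node names are taken in `ν` and edge names
in `ε`. The values of `label`, `prems`, `concls` outside `nodes`, and of `type` outside `edges`, are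
irrelevant. -/
structure NetGraph (α ν ε : Type*) where
  nodes : Finset ν
  edges : Finset ε
  label : ν → NodeLabel
  /-- the premises of a node, from left to right -/
  prems : ν → List ε
  /-- the conclusions of a node, from left to right -/
  concls : ν → List ε
  type : ε → MLLFormula α

namespace NetGraph

variable {α ν ε : Type*}

/-- `N` is a typed graph: the edges at each node respect the typing of its label, and an edge is the
conclusion of at most one node and the premise of at most one node. -/
structure IsTyped (N : NetGraph α ν ε) : Prop where
  prems_mem : ∀ v ∈ N.nodes, ∀ x ∈ N.prems v, x ∈ N.edges
  concls_mem : ∀ v ∈ N.nodes, ∀ x ∈ N.concls v, x ∈ N.edges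
  typing : ∀ v ∈ N.nodes,
    (N.label v).Typing ((N.prems v).map N.type) ((N.concls v).map N.type)
  prems_nodup : ∀ v ∈ N.nodes, (N.prems v).Nodup
  concls_nodup : ∀ v ∈ N.nodes, (N.concls v).Nodup
  prems_unique : ∀ v ∈ N.nodes, ∀ w ∈ N.nodes, ∀ x, x ∈ N.prems v → x ∈ N.prems w → v = w
  concls_unique : ∀ v ∈ N.nodes, ∀ w ∈ N.nodes, ∀ x, x ∈ N.concls v → x ∈ N.concls w → v = w

/-- `x` is a pending edge (premise of no node); for a proof-net these are its conclusions. -/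
def IsConclusion (N : NetGraph α ν ε) (x : ε) : Prop :=
  x ∈ N.edges ∧ ∀ v ∈ N.nodes, x ∉ N.prems v

/-- The edge `x` joins the nodes `v` and `w` (in either direction). -/
def Joins (N : NetGraph α ν ε) (x : ε) (v w : ν) : Prop :=
  v ∈ N.nodes ∧ w ∈ N.nodes ∧
    ((x ∈ N.concls v ∧ x ∈ N.prems w) ∨ (x ∈ N.concls w ∧ x ∈ N.prems v))

/-- A cycle of length `k + 1` of the underlying undirected multigraph: pairwise distinct nodes
`v 0, …, v k` and pairwise distinct edges `x 0, …, x k`, where `x i` joins `v i` and `v (i + 1)`,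
indices being read modulo `k + 1`. -/
structure IsCycle (N : NetGraph α ν ε) {k : ℕ} (v : Fin (k + 1) → ν) (x : Fin (k + 1) → ε) :
    Prop where
  nodes_injective : Function.Injective v
  edges_injective : Function.Injective x
  joins : ∀ i, N.Joins (x i) (v i) (v (i + 1))

/-- Correctness: every cycle uses two premises of a same `par`-node or of a same
contraction-node. -/
def IsCorrect (N : NetGraph α ν ε) : Prop :=
  ∀ (k : ℕ) (v : Fin (k + 1) → ν) (x : Fin (k + 1) → ε), N.IsCycle v x →
    ∃ w ∈ N.nodes, (N.label w = .par ∨ N.label w = .contr) ∧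
      ∃ i j, i ≠ j ∧ x i ∈ N.prems w ∧ x j ∈ N.prems w

/-- Proof-nets: correct typed graphs in which every edge is the conclusion of some node. -/
structure IsProofNet (N : NetGraph α ν ε) : Prop where
  typed : N.IsTyped
  edge_is_concl : ∀ x ∈ N.edges, ∃ v ∈ N.nodes, x ∈ N.concls v
  correct : N.IsCorrect

/-- The graph with node set `W` and edge set `F` and all labels and incidences inherited
from `N`. -/
def restrict (N : NetGraph α ν ε) (W : Finset ν) (F : Finset ε) : NetGraph α ν ε :=
  { N with nodes := W, edges := F }

/-- `M` reduces to `N` by one `⊗/⅋`-step. The redex is the cut `c` between the conclusion `e` of the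
`⊗`-node `t`, of premises `a, b`, and the conclusion `f` of the `⅋`-node `p`, of premises `a', b'`.
These three nodes and the two edges `e, f` are replaced by two new cuts, `c₁` between `a` and `a'`
and `c₂` between `b` and `b'`; everything else is left unchanged. -/
structure TensorParStep (M N : NetGraph α ν ε) (c t p : ν) (e f a b a' b' : ε) (c₁ c₂ : ν) :
    Prop where
  c_mem : c ∈ M.nodes
  t_mem : t ∈ M.nodes
  p_mem : p ∈ M.nodes
  c_label : M.label c = .cut
  t_label : M.label t = .tensor
  p_label : M.label p = .par
  c_prems : (M.prems c).Perm [e, f]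
  t_prems : M.prems t = [a, b]
  t_concls : M.concls t = [e]
  p_prems : M.prems p = [a', b']
  p_concls : M.concls p = [f]
  c₁_fresh : c₁ ∉ M.nodes
  c₂_fresh : c₂ ∉ M.nodes
  c₁_ne_c₂ : c₁ ≠ c₂
  mem_nodes : ∀ v, v ∈ N.nodes ↔ (v ∈ M.nodes ∧ v ≠ c ∧ v ≠ t ∧ v ≠ p) ∨ v = c₁ ∨ v = c₂
  mem_edges : ∀ x, x ∈ N.edges ↔ x ∈ M.edges ∧ x ≠ e ∧ x ≠ f
  c₁_label : N.label c₁ = .cut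
  c₂_label : N.label c₂ = .cut
  c₁_prems : (N.prems c₁).Perm [a, a']
  c₂_prems : (N.prems c₂).Perm [b, b']
  c₁_concls : N.concls c₁ = []
  c₂_concls : N.concls c₂ = []
  nodes_unchanged : ∀ v ∈ M.nodes, v ≠ c → v ≠ t → v ≠ p →
    N.label v = M.label v ∧ N.prems v = M.prems v ∧ N.concls v = M.concls v
  edges_unchanged : ∀ x ∈ N.edges, N.type x = M.type x

end NetGraph

/-- A graph together with `n` chosen subgraphs, given by their nodes and edges. -/
structure PartitionedNet (α ν ε : Type*) (n : ℕ) where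
  net : NetGraph α ν ε
  partNodes : Fin n → Finset ν
  partEdges : Fin n → Finset ε

namespace PartitionedNet

variable {α ν ε : Type*} {n : ℕ}

/-- The `i`-th chosen subgraph. -/
def part (R : PartitionedNet α ν ε n) (i : Fin n) : NetGraph α ν ε :=
  R.net.restrict (R.partNodes i) (R.partEdges i)

/-- `c` is a cut-node which lies in none of the chosen subgraphs and whose two premises are
conclusions of the `i`-th and of the `j`-th one. -/
def IsCutBetween (R : PartitionedNet α ν ε n) (c : ν) (i j : Fin n) : Prop :=
  c ∈ R.net.nodes ∧ (∀ k, c ∉ R.partNodes k) ∧ R.net.label c = .cut ∧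
    ∃ a b, (R.net.prems c).Perm [a, b] ∧ (R.part i).IsConclusion a ∧ (R.part j).IsConclusion b

theorem IsCutBetween.symm {R : PartitionedNet α ν ε n} {c : ν} {i j : Fin n}
    (h : R.IsCutBetween c i j) : R.IsCutBetween c j i := by
  obtain ⟨hc, hk, hl, a, b, hp, ha, hb⟩ := h
  exact ⟨hc, hk, hl, b, a, hp.trans (List.Perm.swap b a []), hb, ha⟩

/-- The proof-net `R.net` is partitioned into the sub-nets `R.part i` and cut-nodes which separate
them. -/
structure IsPartition (R : PartitionedNet α ν ε n) : Prop where
  isProofNet : R.net.IsProofNet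
  partNodes_subset : ∀ i, R.partNodes i ⊆ R.net.nodes
  partEdges_subset : ∀ i, R.partEdges i ⊆ R.net.edges
  part_isProofNet : ∀ i, (R.part i).IsProofNet
  partNodes_disjoint : ∀ i j, i ≠ j → Disjoint (R.partNodes i) (R.partNodes j)
  partEdges_disjoint : ∀ i j, i ≠ j → Disjoint (R.partEdges i) (R.partEdges j)
  edges_covered : ∀ x ∈ R.net.edges, ∃ i, x ∈ R.partEdges i
  nodes_covered : ∀ v ∈ R.net.nodes,
    (∃ i, v ∈ R.partNodes i) ∨ ∃ i j, i ≠ j ∧ R.IsCutBetween v i j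

/-- The skeleton: its vertices are the sub-nets, adjacent when there is at least one cut between
them. -/
def skeleton (R : PartitionedNet α ν ε n) : SimpleGraph (Fin n) where
  Adj i j := i ≠ j ∧ ∃ c, R.IsCutBetween c i j
  symm := ⟨fun _ _ ⟨hij, c, hc⟩ => ⟨hij.symm, c, hc.symm⟩⟩
  loopless := ⟨fun _ h => h.1 rfl⟩

/-- Cut-nets. -/
structure IsCutNet (R : PartitionedNet α ν ε n) : Prop where
  isPartition : R.IsPartition
  skeleton_isTree : R.skeleton.IsTree

/-- `R'` is obtained from `R` by one `⊗/⅋`-expansion on two cuts between the `i`-th and the `j`-th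
sub-net, which puts the new `⊗`-node in the `i`-th and the new `⅋`-node in the `j`-th sub-net; the
other sub-nets keep their nodes and edges. Both `R` and `R'` have to be proof-nets. -/
def ExpandsAt (R R' : PartitionedNet α ν ε n) (i j : Fin n) : Prop :=
  R.net.IsProofNet ∧ R'.net.IsProofNet ∧ i ≠ j ∧
  ∃ (c t p : ν) (e f a b a' b' : ε) (c₁ c₂ : ν),
    R'.net.TensorParStep R.net c t p e f a b a' b' c₁ c₂ ∧
    R.IsCutBetween c₁ i j ∧ R.IsCutBetween c₂ i j ∧
    a ∈ R.partEdges i ∧ b ∈ R.partEdges i ∧ a' ∈ R.partEdges j ∧ b' ∈ R.partEdges j ∧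
    (∀ k v, v ∈ R'.partNodes k ↔ v ∈ R.partNodes k ∨ (k = i ∧ v = t) ∨ (k = j ∧ v = p)) ∧
    (∀ k x, x ∈ R'.partEdges k ↔ x ∈ R.partEdges k ∨ (k = i ∧ x = e) ∨ (k = j ∧ x = f))

/-- One `⊗/⅋`-expansion on cuts between some pair of sub-nets. -/
def Expands (R R' : PartitionedNet α ν ε n) : Prop :=
  ∃ i j, R.ExpandsAt R' i j

end PartitionedNet

/-! Let two edges at a node have the same colour when they are premises of a same `⅋`- or
contraction node, and call a pair of consecutive edges of the same colour a cusp. A typed graph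
is correct iff each of its cycles has a cusp, and Yeo's theorem then provides a node at which
every cycle through it has a cusp.

Suppose that there are several cuts between `R_i` and `R_j`. Since the skeleton is a tree,
removing its edge between `i` and `j` splits the net into two sides, and a path can only change
sides at one of these cuts. With Yeo's theorem one finds two of them, `c₁` and `c₂`, such that
the cusp-free paths from `c₁` to `c₂` all stay on one side. The `⅋`-node is put on that side,
the `⊗`-node on the other. A cusp-free cycle of the expanded net would cross the `⊗`-node;
contracting the new nodes turns it into a cusp-free cycle of the given net, or into a cusp-free
path between `c₁` and `c₂` through a premise of the `⊗`-node, and neither exists. Each such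
expansion decreases the number of cuts.
-/

/-- An edge of a multigraph together with a direction in which it is crossed. -/
@[ext]
structure EdgeDart (V E : Type*) where
  src : V
  edge : E
  tgt : V

namespace EdgeDart

open scoped Graph

variable {V E C : Type*}

/-- The same edge, crossed in the other direction. -/
def rev (d : EdgeDart V E) : EdgeDart V E := ⟨d.tgt, d.edge, d.src⟩

@[simp] theorem rev_src (d : EdgeDart V E) : d.rev.src = d.tgt := rfl
@[simp] theorem rev_tgt (d : EdgeDart V E) : d.rev.tgt = d.src := rfl
@[simp] theorem rev_edge (d : EdgeDart V E) : d.rev.edge = d.edge := rfl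
@[simp] theorem rev_rev (d : EdgeDart V E) : d.rev.rev = d := rfl

/-- The vertices visited by a walk, the last one excepted. -/
def srcs (l : List (EdgeDart V E)) : List V := l.map src

@[simp] theorem srcs_nil : srcs ([] : List (EdgeDart V E)) = [] := rfl

@[simp] theorem srcs_cons (d : EdgeDart V E) (l : List (EdgeDart V E)) :
    srcs (d :: l) = d.src :: srcs l := rfl

@[simp] theorem srcs_append (l l' : List (EdgeDart V E)) : srcs (l ++ l') = srcs l ++ srcs l' :=
  List.map_append

theorem mem_srcs {x : V} {l : List (EdgeDart V E)} : x ∈ srcs l ↔ ∃ d ∈ l, d.src = x :=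
  List.mem_map

/-- The walk crossed backwards. -/
def revWalk (l : List (EdgeDart V E)) : List (EdgeDart V E) := (l.map rev).reverse

@[simp] theorem revWalk_nil : revWalk ([] : List (EdgeDart V E)) = [] := rfl

@[simp] theorem revWalk_cons (d : EdgeDart V E) (l : List (EdgeDart V E)) :
    revWalk (d :: l) = revWalk l ++ [d.rev] := by
  simp [revWalk]

@[simp] theorem revWalk_append (l l' : List (EdgeDart V E)) :
    revWalk (l ++ l') = revWalk l' ++ revWalk l := by
  simp [revWalk]

@[simp] theorem revWalk_revWalk (l : List (EdgeDart V E)) : revWalk (revWalk l) = l := by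
  induction l with
  | nil => rfl
  | cons d l ih => simp [ih]

@[simp] theorem revWalk_eq_nil {l : List (EdgeDart V E)} : revWalk l = [] ↔ l = [] := by
  simp [revWalk]

theorem mem_revWalk {d : EdgeDart V E} {l : List (EdgeDart V E)} : d ∈ revWalk l ↔ d.rev ∈ l := by
  induction l with
  | nil => simp
  | cons d' l ih => simp [ih, or_comm, EdgeDart.ext_iff, and_left_comm, and_comm]

/-- `IsWalk G u l w`: the darts `l`, crossed one after the other, lead from `u` to `w` in `G`. -/
def IsWalk (G : Graph V E) : V → List (EdgeDart V E) → V → Prop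
  | u, [], w => u = w
  | u, d :: l, w => d.src = u ∧ G.IsLink d.edge d.src d.tgt ∧ IsWalk G d.tgt l w

section Walk

variable {G H : Graph V E} {u v w x : V} {l l' : List (EdgeDart V E)}

theorem isWalk_append : IsWalk G u (l ++ l') w ↔ ∃ v, IsWalk G u l v ∧ IsWalk G v l' w := by
  induction l generalizing u with
  | nil => simp [IsWalk]
  | cons d l ih => simp [IsWalk, ih, and_assoc]

theorem IsWalk.append (h : IsWalk G u l v) (h' : IsWalk G v l' w) : IsWalk G u (l ++ l') w :=
  isWalk_append.2 ⟨v, h, h'⟩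

theorem isWalk_singleton {d : EdgeDart V E} :
    IsWalk G u [d] w ↔ d.src = u ∧ G.IsLink d.edge d.src d.tgt ∧ d.tgt = w := Iff.rfl

theorem isWalk_concat {d : EdgeDart V E} :
    IsWalk G u (l ++ [d]) w ↔ IsWalk G u l d.src ∧ G.IsLink d.edge d.src d.tgt ∧ d.tgt = w := by
  simp [isWalk_append, isWalk_singleton]

theorem IsWalk.revWalk (h : IsWalk G u l w) : IsWalk G w (revWalk l) u := by
  induction l generalizing u with
  | nil => exact h.symm
  | cons d l ih =>
    obtain ⟨rfl, hd, hl⟩ := h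
    rw [revWalk_cons, isWalk_concat]
    exact ⟨ih hl, hd.symm, rfl⟩

theorem IsWalk.isLink (h : IsWalk G u l w) : ∀ d ∈ l, G.IsLink d.edge d.src d.tgt := by
  induction l generalizing u with
  | nil => simp
  | cons d l ih => exact List.forall_mem_cons.2 ⟨h.2.1, ih h.2.2⟩

theorem IsWalk.congr (h : IsWalk G u l w) (hl : ∀ d ∈ l, H.IsLink d.edge d.src d.tgt) :
    IsWalk H u l w := by
  induction l generalizing u with
  | nil => exact h
  | cons d l ih =>
    obtain ⟨hd, hl⟩ := List.forall_mem_cons.1 hl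
    exact ⟨h.1, hd, ih h.2.2 hl⟩

theorem IsWalk.mono (hGH : G ≤ H) (h : IsWalk G u l w) : IsWalk H u l w :=
  h.congr fun d hd => (h.isLink d hd).mono hGH

theorem IsWalk.start_mem_srcs (h : IsWalk G u l w) (hl : l ≠ []) : u ∈ srcs l := by
  cases l with
  | nil => exact absurd rfl hl
  | cons d l => simp [h.1]

theorem IsWalk.tgt_mem (h : IsWalk G u l w) : ∀ d ∈ l, d.tgt ∈ w :: srcs l := by
  induction l generalizing u with
  | nil => simp
  | cons d l ih =>
    refine List.forall_mem_cons.2 ⟨?_, fun d' hd' => ?_⟩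
    · cases l with
      | nil => simp [show d.tgt = w from h.2.2]
      | cons d' l => simp [h.2.2.1]
    · have := ih h.2.2 d' hd'
      grind [srcs_cons]

theorem IsWalk.end_mem (h : IsWalk G u l w) (hu : u ∈ V(G)) : w ∈ V(G) := by
  induction l generalizing u with
  | nil => exact h ▸ hu
  | cons d l ih => exact ih h.2.2 h.2.1.right_mem

theorem IsWalk.exists_split (h : IsWalk G u l w) (hx : x ∈ srcs l) :
    ∃ l₁ l₂, l = l₁ ++ l₂ ∧ l₂ ≠ [] ∧ IsWalk G u l₁ x ∧ IsWalk G x l₂ w := by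
  obtain ⟨d, hd, rfl⟩ := mem_srcs.1 hx
  obtain ⟨l₁, l₂, rfl⟩ := List.append_of_mem hd
  obtain ⟨v, h₁, h₂⟩ := isWalk_append.1 h
  obtain rfl : d.src = v := h₂.1
  exact ⟨l₁, d :: l₂, rfl, by simp, h₁, h₂⟩

/-- A walk whose visited vertices are pairwise distinct. -/
structure IsPath (G : Graph V E) (u : V) (l : List (EdgeDart V E)) (w : V) : Prop where
  isWalk : IsWalk G u l w
  nodup : (w :: srcs l).Nodup

theorem IsPath.end_notMem (h : IsPath G u l w) : w ∉ srcs l := (List.nodup_cons.1 h.nodup).1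

theorem IsPath.nodup_srcs (h : IsPath G u l w) : (srcs l).Nodup := (List.nodup_cons.1 h.nodup).2

theorem IsPath.nil : IsPath G u [] u := ⟨rfl, by simp⟩

theorem IsPath.append (h : IsPath G u l v) (h' : IsPath G v l' w)
    (hll' : (srcs l).Disjoint (srcs l')) (hw : w ∉ srcs l) : IsPath G u (l ++ l') w :=
  ⟨h.isWalk.append h'.isWalk, by
    simp [List.nodup_append', h.nodup_srcs, h'.nodup_srcs, hll', hw, h'.end_notMem]⟩

theorem IsPath.exists_split (h : IsPath G u l w) (hx : x ∈ srcs l) :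
    ∃ l₁ l₂, l = l₁ ++ l₂ ∧ l₂ ≠ [] ∧ IsPath G u l₁ x ∧ IsPath G x l₂ w := by
  obtain ⟨l₁, l₂, rfl, hne, h₁, h₂⟩ := h.isWalk.exists_split hx
  have hx₂ := h₂.start_mem_srcs hne
  have hn := h.nodup
  simp only [srcs_append, List.nodup_cons, List.mem_append, not_or, List.nodup_append'] at hn
  obtain ⟨⟨-, hw⟩, hn₁, hn₂, hdisj⟩ := hn
  exact ⟨l₁, l₂, rfl, hne, ⟨h₁, List.nodup_cons.2 ⟨fun hx₁ => hdisj hx₁ hx₂, hn₁⟩⟩,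
    ⟨h₂, List.nodup_cons.2 ⟨hw, hn₂⟩⟩⟩

theorem IsWalk.srcs_revWalk_perm (h : IsWalk G u l w) :
    (u :: srcs (EdgeDart.revWalk l)).Perm (w :: srcs l) := by
  induction l generalizing u with
  | nil => cases h; rfl
  | cons d l ih =>
    obtain ⟨rfl, -, h⟩ := h
    rw [revWalk_cons, srcs_append, srcs_cons, srcs_cons, srcs_nil, rev_src]
    exact (((List.perm_append_singleton _ _).trans (ih h)).cons _).trans (.swap _ _ _)

theorem IsPath.revWalk (h : IsPath G u l w) : IsPath G w (revWalk l) u :=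
  ⟨h.isWalk.revWalk, h.isWalk.srcs_revWalk_perm.nodup_iff.2 h.nodup⟩

theorem IsPath.mem_srcs_revWalk (h : IsPath G u l w) :
    x ∈ srcs (EdgeDart.revWalk l) ↔ x ≠ u ∧ (x = w ∨ x ∈ srcs l) := by
  have hmem := h.isWalk.srcs_revWalk_perm.mem_iff (a := x)
  have := h.revWalk.end_notMem
  grind

theorem IsWalk.exists_isPath (h : IsWalk G u l w) : ∃ l', IsPath G u l' w := by
  classical
  induction l generalizing u with
  | nil => cases h; exact ⟨[], .nil⟩
  | cons d l ih =>
    obtain ⟨rfl, hd, h⟩ := h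
    obtain ⟨l', hl'⟩ := ih h
    by_cases hmem : d.src ∈ w :: srcs l'
    · rcases List.mem_cons.1 hmem with hw | hmem
      · exact ⟨[], hw ▸ .nil⟩
      · obtain ⟨-, l₂, -, -, -, h₂⟩ := hl'.exists_split hmem
        exact ⟨l₂, h₂⟩
    · refine ⟨d :: l', ⟨rfl, hd, hl'.isWalk⟩, ?_⟩
      simpa [hl'.nodup_srcs, hl'.end_notMem, eq_comm, and_comm] using hmem

/-- A nonempty closed walk at `v` which visits no other vertex twice. It may go back along the edge
by which it came, but that is a cusp for any local colouring. -/
structure IsCycle (G : Graph V E) (v : V) (l : List (EdgeDart V E)) : Prop where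
  isWalk : IsWalk G v l v
  nodup : (srcs l).Nodup
  ne_nil : l ≠ []

theorem IsCycle.mono (hGH : G ≤ H) (h : IsCycle G v l) : IsCycle H v l :=
  ⟨h.isWalk.mono hGH, h.nodup, h.ne_nil⟩

theorem IsCycle.revWalk (h : IsCycle G v l) : IsCycle G v (revWalk l) :=
  ⟨h.isWalk.revWalk, ((List.perm_cons v).1 h.isWalk.srcs_revWalk_perm).nodup_iff.2 h.nodup,
    by simpa using h.ne_nil⟩

theorem IsCycle.disjoint_srcs (h : IsCycle G v (l ++ l')) : (srcs l).Disjoint (srcs l') :=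
  (List.nodup_append'.1 (srcs_append l l' ▸ h.nodup)).2.2

theorem IsCycle.exists_isPath_of_append (h : IsCycle G v (l ++ l')) (hl : l ≠ [])
    (hl' : l' ≠ []) : ∃ u, IsPath G v l u ∧ IsPath G u l' v := by
  obtain ⟨u, hu, hu'⟩ := isWalk_append.1 h.isWalk
  obtain ⟨hn, hn', hdisj⟩ := List.nodup_append'.1 (srcs_append l l' ▸ h.nodup)
  exact ⟨u, ⟨hu, List.nodup_cons.2 ⟨fun hmem => hdisj hmem (hu'.start_mem_srcs hl'), hn⟩⟩,
    ⟨hu', List.nodup_cons.2 ⟨fun hmem => hdisj (hu.start_mem_srcs hl) hmem, hn'⟩⟩⟩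

theorem IsPath.isCycle_append (h : IsPath G u l v) (h' : IsPath G v l' u)
    (hll' : (srcs l).Disjoint (srcs l')) (hl : l ≠ []) : IsCycle G u (l ++ l') :=
  ⟨h.isWalk.append h'.isWalk,
    by simp [List.nodup_append', h.nodup_srcs, h'.nodup_srcs, hll'], by simp [hl]⟩

theorem IsPath.cons_concat {x x' : E} {y z : V} (hx : G.IsLink x u y) (hl : IsPath G y l z)
    (hx' : G.IsLink x' z w) (hu : u ∉ z :: srcs l) (hw : w ∉ z :: srcs l) (huw : u ≠ w) :
    IsPath G u (⟨u, x, y⟩ :: (l ++ [⟨z, x', w⟩])) w := by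
  refine ⟨⟨rfl, hx, isWalk_concat.2 ⟨hl.isWalk, hx', rfl⟩⟩, ?_⟩
  have := hl.nodup_srcs
  have := hl.end_notMem
  simp only [srcs_cons, srcs_append, srcs_nil]
  grind

theorem IsPath.isCycle_cons_concat {x x' : E} {y z : V} (hx : G.IsLink x u y) (hl : IsPath G y l z)
    (hx' : G.IsLink x' z u) (hu : u ∉ z :: srcs l) :
    IsCycle G u (⟨u, x, y⟩ :: (l ++ [⟨z, x', u⟩])) := by
  refine ⟨⟨rfl, hx, isWalk_concat.2 ⟨hl.isWalk, hx', rfl⟩⟩, ?_, by simp⟩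
  have := hl.nodup_srcs
  have := hl.end_notMem
  simp only [srcs_cons, srcs_append, srcs_nil]
  grind

theorem IsCycle.exists_eq_cons_concat (h : IsCycle G v l) (hloop : ∀ x, ¬ G.IsLink x v v) :
    ∃ (x : E) (y : V) (m : List (EdgeDart V E)) (z : V) (x' : E),
      l = ⟨v, x, y⟩ :: (m ++ [⟨z, x', v⟩]) ∧ G.IsLink x v y ∧ IsPath G y m z ∧
        G.IsLink x' z v ∧ v ∉ z :: srcs m := by
  obtain ⟨hw, hn, hne⟩ := h
  obtain _ | ⟨⟨u, x, y⟩, r⟩ := l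
  · exact absurd rfl hne
  obtain ⟨rfl, hx, hr⟩ : u = v ∧ G.IsLink x u y ∧ IsWalk G y r v := hw
  obtain rfl | ⟨m, ⟨z, x', v⟩, rfl⟩ := r.eq_nil_or_concat'
  · exact absurd ((show y = u from hr) ▸ hx) (hloop x)
  obtain ⟨hm, hx', rfl⟩ := isWalk_concat.1 hr
  simp only [srcs_cons, srcs_append, srcs_nil] at hn
  exact ⟨x, y, m, z, x', rfl, hx, ⟨hm, by grind⟩, hx', by grind⟩

end Walk

section Cusp

variable {col : V → E → C} {l l' l₁ l₂ : List (EdgeDart V E)}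

/-- The colour of the first edge of a walk at the vertex where the walk starts; here and below
`col v x` is the colour of the edge `x` at its end `v`. -/
def startColor (col : V → E → C) (l : List (EdgeDart V E)) : Option C :=
  l.head?.map fun d => col d.src d.edge

/-- The colour of the last edge of a walk at the vertex where the walk ends. -/
def endColor (col : V → E → C) (l : List (EdgeDart V E)) : Option C :=
  l.getLast?.map fun d => col d.tgt d.edge

@[simp] theorem startColor_nil : startColor col [] = none := rfl

@[simp] theorem startColor_cons (d : EdgeDart V E) :
    startColor col (d :: l) = some (col d.src d.edge) := rfl

@[simp] theorem endColor_nil : endColor col [] = none := rfl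

@[simp] theorem endColor_concat (d : EdgeDart V E) :
    endColor col (l ++ [d]) = some (col d.tgt d.edge) := by
  simp [endColor]

@[simp] theorem endColor_singleton (d : EdgeDart V E) :
    endColor col [d] = some (col d.tgt d.edge) := rfl

theorem startColor_append :
    startColor col (l ++ l') = (startColor col l).or (startColor col l') := by
  cases l <;> rfl

theorem endColor_append : endColor col (l ++ l') = (endColor col l').or (endColor col l) := by
  obtain rfl | ⟨l', d, rfl⟩ := l'.eq_nil_or_concat'
  · simp
  · rw [← List.append_assoc, endColor_concat, endColor_concat, Option.some_or]

theorem startColor_append_of_ne_nil (hl : l ≠ []) :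
    startColor col (l ++ l') = startColor col l := by
  cases l with
  | nil => exact absurd rfl hl
  | cons d l => rfl

theorem endColor_append_of_ne_nil (hl' : l' ≠ []) : endColor col (l ++ l') = endColor col l' := by
  obtain rfl | ⟨l', d, rfl⟩ := l'.eq_nil_or_concat'
  · exact absurd rfl hl'
  · simp [endColor_append]

@[simp] theorem startColor_revWalk : startColor col (revWalk l) = endColor col l := by
  simp [startColor, endColor, revWalk, Function.comp_def]

@[simp] theorem endColor_revWalk : endColor col (revWalk l) = startColor col l := by
  simp [startColor, endColor, revWalk, Function.comp_def]

/-- The last edge of `l` and the first edge of `l'` do not form a cusp, that is, a pair of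
consecutive edges of the same colour. -/
def NoCusp (col : V → E → C) (l l' : List (EdgeDart V E)) : Prop :=
  ∀ k ∈ endColor col l, k ∉ startColor col l'

theorem endColor_eq_startColor (h : ¬ NoCusp col l l') : endColor col l = startColor col l' := by
  simp only [NoCusp, Option.mem_def] at h
  grind

/-- No two consecutive edges have the same colour at the vertex they share. -/
def CuspFree (col : V → E → C) (l : List (EdgeDart V E)) : Prop :=
  l.IsChain fun d₁ d₂ => col d₁.tgt d₁.edge ≠ col d₂.src d₂.edge

theorem noCusp_singleton_cons {d d' : EdgeDart V E} :
    NoCusp col [d] (d' :: l) ↔ col d.tgt d.edge ≠ col d'.src d'.edge := by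
  simp [NoCusp, eq_comm]

@[simp] theorem noCusp_nil_left : NoCusp col [] l := by simp [NoCusp]

@[simp] theorem noCusp_nil_right : NoCusp col l [] := by simp [NoCusp]

theorem ne_nil_left_of_not_noCusp (h : ¬ NoCusp col l l') : l ≠ [] := by
  rintro rfl
  exact h noCusp_nil_left

theorem ne_nil_right_of_not_noCusp (h : ¬ NoCusp col l l') : l' ≠ [] := by
  rintro rfl
  exact h noCusp_nil_right

theorem NoCusp.revWalk (h : NoCusp col l l') :
    NoCusp col (EdgeDart.revWalk l') (EdgeDart.revWalk l) := by
  simp only [NoCusp, endColor_revWalk, startColor_revWalk]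
  exact fun k hk hk' => h k hk' hk

theorem noCusp_revWalk_revWalk : NoCusp col (revWalk l) (revWalk l') ↔ NoCusp col l' l :=
  ⟨fun h => by simpa only [revWalk_revWalk] using h.revWalk, NoCusp.revWalk⟩

theorem noCusp_append_left (hl₂ : l₂ ≠ []) : NoCusp col (l₁ ++ l₂) l ↔ NoCusp col l₂ l := by
  simp [NoCusp, endColor_append_of_ne_nil hl₂]

theorem noCusp_append_right (hl₁ : l₁ ≠ []) : NoCusp col l (l₁ ++ l₂) ↔ NoCusp col l l₁ := by
  simp [NoCusp, startColor_append_of_ne_nil hl₁]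

theorem NoCusp.of_append_right (h : NoCusp col l (l₁ ++ l₂)) : NoCusp col l l₁ := by
  cases l₁ with
  | nil => exact noCusp_nil_right
  | cons d l₁ => exact h

theorem noCusp_or_noCusp_revWalk (h : NoCusp col l l) (p : List (EdgeDart V E)) :
    NoCusp col p l ∨ NoCusp col p (revWalk l) := by
  simp only [NoCusp, startColor_revWalk, Option.mem_def] at h ⊢
  grind

theorem NoCusp.revWalk_left_of_cusp (hl : ¬ NoCusp col l l') (h : NoCusp col l l₁) :
    NoCusp col (EdgeDart.revWalk l₁) l' := by
  have := noCusp_revWalk_revWalk.2 h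
  rwa [NoCusp, startColor_revWalk, endColor_eq_startColor hl] at this

theorem NoCusp.revWalk_right_of_cusp (hl : ¬ NoCusp col l l') (h : NoCusp col l₁ l') :
    NoCusp col l₁ (EdgeDart.revWalk l) := by
  rwa [NoCusp, startColor_revWalk, endColor_eq_startColor hl]

@[simp] theorem cuspFree_nil : CuspFree col [] := .nil

@[simp] theorem cuspFree_singleton (d : EdgeDart V E) : CuspFree col [d] := .singleton _

theorem cuspFree_append :
    CuspFree col (l ++ l') ↔ CuspFree col l ∧ CuspFree col l' ∧ NoCusp col l l' := by
  simp only [CuspFree, List.isChain_append, NoCusp, endColor, startColor, Option.mem_def,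
    Option.map_eq_some_iff]
  grind

theorem cuspFree_cons {d : EdgeDart V E} :
    CuspFree col (d :: l) ↔ NoCusp col [d] l ∧ CuspFree col l := by
  rw [← List.singleton_append, cuspFree_append]
  simp [and_comm]

theorem CuspFree.revWalk (h : CuspFree col l) : CuspFree col (revWalk l) := by
  unfold CuspFree EdgeDart.revWalk at *
  rw [List.isChain_reverse, List.isChain_map]
  exact h.imp fun _ _ h => h.symm

theorem exists_first_cusp (h : ¬ CuspFree col l) :
    ∃ p p', l = p ++ p' ∧ CuspFree col p ∧ ¬ NoCusp col p p' := by
  induction l using List.reverseRecOn with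
  | nil => exact absurd cuspFree_nil h
  | append_singleton l d ih =>
    by_cases hl : CuspFree col l
    · exact ⟨l, [d], rfl, hl, fun hd => h (cuspFree_append.2 ⟨hl, cuspFree_singleton d, hd⟩)⟩
    · obtain ⟨p, p', rfl, hp, hpp'⟩ := ih hl
      refine ⟨p, p' ++ [d], List.append_assoc .., hp, ?_⟩
      rwa [noCusp_append_right (ne_nil_right_of_not_noCusp hpp')]

open Classical in
/-- The number of cusps of a walk, the possible one between its last and its first edge being left
out. -/
noncomputable def numCusps (col : V → E → C) : List (EdgeDart V E) → ℕ
  | [] => 0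
  | d :: l => (if NoCusp col [d] l then 0 else 1) + numCusps col l

open Classical in
theorem numCusps_append (l l' : List (EdgeDart V E)) : numCusps col (l ++ l') =
    numCusps col l + numCusps col l' + if NoCusp col l l' then 0 else 1 := by
  induction l with
  | nil => simp [numCusps]
  | cons d l ih =>
    rcases eq_or_ne l [] with rfl | hl
    · simp [numCusps, add_comm]
    · have hleft : NoCusp col (d :: l) l' ↔ NoCusp col l l' := noCusp_append_left (l₁ := [d]) hl
      simp only [List.cons_append, numCusps, ih, noCusp_append_right hl, hleft]
      omega

theorem cuspFree_iff_numCusps_eq_zero : CuspFree col l ↔ numCusps col l = 0 := by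
  induction l with
  | nil => simp [numCusps]
  | cons d l ih => simp [cuspFree_cons, numCusps, ih]

theorem numCusps_revWalk (l : List (EdgeDart V E)) :
    numCusps col (revWalk l) = numCusps col l := by
  classical
  induction l with
  | nil => rfl
  | cons d l ih =>
    have hd : NoCusp col (revWalk l) [d.rev] ↔ NoCusp col [d] l :=
      noCusp_revWalk_revWalk (l' := [d])
    simp [numCusps_append, numCusps, ih, hd, add_comm]

end Cusp

section Yeo

variable {G H : Graph V E} {col : V → E → C} {u v w y : V} {p p' q : List (EdgeDart V E)}

/-- Every cycle has a cusp. -/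
def CuspAcyclic (G : Graph V E) (col : V → E → C) : Prop :=
  ∀ v l, IsCycle G v l → CuspFree col l → ¬ NoCusp col l l

/-- Every cycle through `v` has a cusp at `v`. -/
def IsSplitting (G : Graph V E) (col : V → E → C) (v : V) : Prop :=
  ∀ l, IsCycle G v l → ¬ NoCusp col l l

theorem CuspAcyclic.mono (hGH : G ≤ H) (h : CuspAcyclic H col) : CuspAcyclic G col :=
  fun v l hl => h v l (hl.mono hGH)

theorem CuspAcyclic.not_noCusp (h : CuspAcyclic G col) (hp : IsPath G u p v)
    (hq : IsPath G v q u) (hpq : (srcs p).Disjoint (srcs q)) (hp₀ : p ≠ []) (hq₀ : q ≠ [])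
    (hpc : CuspFree col p) (hqc : CuspFree col q) (hnc : NoCusp col p q) : ¬ NoCusp col q p := by
  have := h u (p ++ q) (hp.isCycle_append hq hpq hp₀) (cuspFree_append.2 ⟨hpc, hqc, hnc⟩)
  rwa [noCusp_append_left hq₀, noCusp_append_right hp₀] at this

/-- A cycle at `v`, without cusp at `v`, which has as few cusps as possible. -/
structure IsMinCycle (G : Graph V E) (col : V → E → C) (v : V) (l : List (EdgeDart V E)) : Prop
    extends IsCycle G v l where
  noCusp : NoCusp col l l
  numCusps_le : ∀ l', IsCycle G v l' → NoCusp col l' l' → numCusps col l ≤ numCusps col l'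

theorem exists_isMinCycle (h : ¬ IsSplitting G col v) : ∃ l, IsMinCycle G col v l := by
  simp only [IsSplitting, not_forall, not_not] at h
  obtain ⟨l₀, hl₀, hnc₀⟩ := h
  obtain ⟨l, ⟨hl, hnc⟩, hmin⟩ := (measure (numCusps col)).wf.has_min
    {l | IsCycle G v l ∧ NoCusp col l l} ⟨l₀, hl₀, hnc₀⟩
  exact ⟨l, hl, hnc, fun l' hl' hnc' => not_lt.1 (hmin l' ⟨hl', hnc'⟩)⟩

theorem IsMinCycle.revWalk {l : List (EdgeDart V E)} (h : IsMinCycle G col v l) :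
    IsMinCycle G col v (revWalk l) :=
  ⟨h.toIsCycle.revWalk, h.noCusp.revWalk, by simpa only [numCusps_revWalk] using h.numCusps_le⟩

/-- Otherwise `q`, crossed backwards, is a shortcut which avoids the cusp between `p` and `p'`. -/
theorem IsMinCycle.notMem_srcs_left (hac : CuspAcyclic G col) (h : IsMinCycle G col v (p ++ p'))
    (hp : IsPath G v p u) (hp' : IsPath G u p' v) (hpc : CuspFree col p)
    (hcusp : ¬ NoCusp col p p') (hq : IsPath G u q y) (hqc : CuspFree col q)
    (hpq : NoCusp col p q) (hqp : ∀ x ∈ srcs q, x ≠ u → x ∉ srcs (p ++ p')) : y ∉ srcs p := by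
  classical
  intro hy
  have hp'₀ := ne_nil_right_of_not_noCusp hcusp
  have hu := hp'.isWalk.start_mem_srcs hp'₀
  have hdisj := h.toIsCycle.disjoint_srcs
  have hq₀ : q ≠ [] := by
    rintro rfl
    exact hdisj hy (hq.isWalk ▸ hu)
  obtain ⟨p₁, p₂, rfl, hp₂, hw₁, hw₂⟩ := hp.exists_split hy
  obtain ⟨hc₁, hc₂, hc₁₂⟩ := cuspFree_append.1 hpc
  have hcusp' : ¬ NoCusp col q p₂ :=
    hac.not_noCusp hw₂ hq (by grind [List.Disjoint, srcs_append]) hp₂ hq₀ hc₂ hqc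
      ((noCusp_append_left hp₂).1 hpq)
  have hcycle : IsCycle G v (p₁ ++ EdgeDart.revWalk q ++ p') := by
    refine ⟨(hw₁.isWalk.append hq.isWalk.revWalk).append hp'.isWalk, ?_, by simp [hp'₀]⟩
    have := hw₂.isWalk.start_mem_srcs hp₂
    have hrev := fun x => hq.mem_srcs_revWalk (x := x)
    have := hq.revWalk.nodup_srcs
    have := hw₁.nodup
    have := hp'.nodup
    simp only [srcs_append, List.nodup_append']
    grind [List.Disjoint, srcs_append]
  have hstart : startColor col (p₁ ++ EdgeDart.revWalk q) = startColor col (p₁ ++ p₂) := by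
    rw [startColor_append, startColor_append, startColor_revWalk, endColor_eq_startColor hcusp']
  have hnc : NoCusp col (p₁ ++ EdgeDart.revWalk q ++ p') (p₁ ++ EdgeDart.revWalk q ++ p') := by
    have hnc := h.noCusp
    rw [noCusp_append_left hp'₀, noCusp_append_right (by simp [hp₂]), NoCusp] at hnc
    rwa [noCusp_append_left hp'₀, noCusp_append_right (by simp [hq₀]), NoCusp, hstart]
  have hnew : numCusps col (p₁ ++ EdgeDart.revWalk q ++ p') = numCusps col p' := by
    rw [numCusps_append, numCusps_append, cuspFree_iff_numCusps_eq_zero.1 hc₁,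
      cuspFree_iff_numCusps_eq_zero.1 hqc.revWalk, if_pos (hc₁₂.revWalk_right_of_cusp hcusp'),
      if_pos, Nat.zero_add, Nat.add_zero]
    rw [noCusp_append_left (by simpa using hq₀)]
    exact hpq.revWalk_left_of_cusp hcusp
  have hold : numCusps col (p₁ ++ p₂ ++ p') = numCusps col p' + 1 := by
    rw [numCusps_append, cuspFree_iff_numCusps_eq_zero.1 hpc, if_neg hcusp, Nat.zero_add]
  have hle := h.numCusps_le _ hcycle hnc
  omega

/-- Otherwise `q` is a shortcut; as it cannot save a cusp, it forms a cycle without cusps together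
with the part of the given cycle which it replaces. -/
theorem IsMinCycle.notMem_srcs_right (hac : CuspAcyclic G col) (h : IsMinCycle G col v (p ++ p'))
    (hp : IsPath G v p u) (hp' : IsPath G u p' v) (hpc : CuspFree col p)
    (hcusp : ¬ NoCusp col p p') (hq : IsPath G u q y) (hqc : CuspFree col q)
    (hpq : NoCusp col p q) (hqp : ∀ x ∈ srcs q, x ≠ u → x ∉ srcs (p ++ p')) (hyu : y ≠ u) :
    y ∉ srcs p' := by
  classical
  intro hy
  have hq₀ : q ≠ [] := by
    rintro rfl
    exact hyu hq.isWalk.symm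
  have hp₀ := ne_nil_left_of_not_noCusp hcusp
  have hu := hp'.isWalk.start_mem_srcs (ne_nil_right_of_not_noCusp hcusp)
  have hdisj := h.toIsCycle.disjoint_srcs
  obtain ⟨p₁, p₂, rfl, hp₂, hw₁, hw₂⟩ := hp'.exists_split hy
  have hp₁ : p₁ ≠ [] := by
    rintro rfl
    exact hyu hw₁.isWalk.symm
  have hu₁ := hw₁.isWalk.start_mem_srcs hp₁
  have hnodup := hp'.nodup_srcs
  have hcycle : IsCycle G v (p ++ (q ++ p₂)) := by
    refine ⟨hp.isWalk.append (hq.isWalk.append hw₂.isWalk), ?_, by simp [hp₀]⟩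
    have := hp.nodup_srcs
    have := hq.nodup_srcs
    simp only [srcs_append, List.nodup_append'] at hnodup ⊢
    grind [List.Disjoint, srcs_append]
  have hnc : NoCusp col (p ++ (q ++ p₂)) (p ++ (q ++ p₂)) := by
    have hnc := h.noCusp
    rw [noCusp_append_right hp₀] at hnc ⊢
    rw [noCusp_append_left (by simp [hp₂]), noCusp_append_left hp₂] at hnc ⊢
    exact hnc
  have hle := h.numCusps_le _ hcycle hnc
  simp only [numCusps_append, cuspFree_iff_numCusps_eq_zero.1 hpc,
    cuspFree_iff_numCusps_eq_zero.1 hqc, if_neg hcusp,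
    if_pos ((noCusp_append_right hq₀).2 hpq)] at hle
  have hnc₁ : NoCusp col p₁ p₂ := by grind
  have hcusp₂ : ¬ NoCusp col q p₂ := by grind
  have hc₁ : CuspFree col p₁ := cuspFree_iff_numCusps_eq_zero.2 (by grind)
  have hcusp₁ : ¬ NoCusp col p p₁ := fun hnc => hcusp ((noCusp_append_right hp₁).2 hnc)
  refine hac.not_noCusp hq hw₁.revWalk (fun x hx hx' => ?_) hq₀ (by simpa using hp₁) hqc
    hc₁.revWalk
    (by simpa using (hnc₁.revWalk_right_of_cusp hcusp₂).revWalk) ?_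
  · have := hq.end_notMem
    have := hw₁.mem_srcs_revWalk (x := x)
    grind [srcs_append]
  · simpa using (hpq.revWalk_left_of_cusp hcusp₁).revWalk

theorem IsPath.exists_first_visit {A : Set V} (h : IsPath G u q y) (hy : y ∈ A) :
    ∃ q₁ q₂ x, q = q₁ ++ q₂ ∧ IsPath G u q₁ x ∧ x ∈ A ∧ ∀ z ∈ srcs q₁, z ∉ A := by
  classical
  induction q generalizing u with
  | nil => exact ⟨[], [], u, rfl, .nil, h.isWalk ▸ hy, by simp⟩
  | cons d q ih =>
    obtain ⟨⟨rfl, hd, hw⟩, hn⟩ := h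
    by_cases hA : d.src ∈ A
    · exact ⟨[], d :: q, d.src, rfl, .nil, hA, by simp⟩
    · obtain ⟨q₁, q₂, x, rfl, hq₁, hx, hA₁⟩ := ih ⟨hw, by grind [srcs_cons]⟩
      refine ⟨d :: q₁, q₂, x, rfl, ⟨⟨rfl, hd, hq₁.isWalk⟩, ?_⟩, hx, by simpa [hA] using hA₁⟩
      have := hq₁.nodup
      grind [srcs_cons, srcs_append]

/-- The walk `p` ends at `u`, and no cusp-free prolongation of `p` comes back to it. -/
def NoReturn (G : Graph V E) (col : V → E → C) (p : List (EdgeDart V E)) (u : V) : Prop :=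
  ∀ q y, IsPath G u q y → CuspFree col q → NoCusp col p q → y ∉ srcs p

theorem IsMinCycle.noReturn (hac : CuspAcyclic G col) (h : IsMinCycle G col v (p ++ p'))
    (hp : IsPath G v p u) (hp' : IsPath G u p' v) (hpc : CuspFree col p)
    (hcusp : ¬ NoCusp col p p') : NoReturn G col p u := by
  intro q y hq hqc hpq hy
  obtain ⟨q₁, q₂, x, rfl, hpath, ⟨hx, hxu⟩, hq₁⟩ :=
    hq.exists_first_visit (A := {x | x ∈ srcs (p ++ p') ∧ x ≠ u})
      ⟨by simp [hy], fun hyu => hp.end_notMem (hyu ▸ hy)⟩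
  have hqp : ∀ x ∈ srcs q₁, x ≠ u → x ∉ srcs (p ++ p') := fun x hx hxu hmem => hq₁ x hx ⟨hmem, hxu⟩
  have hqc₁ := (cuspFree_append.1 hqc).1
  rcases List.mem_append.1 (srcs_append p p' ▸ hx) with hx | hx
  · exact h.notMem_srcs_left hac hp hp' hpc hcusp hpath hqc₁ hpq.of_append_right hqp hx
  · exact h.notMem_srcs_right hac hp hp' hpc hcusp hpath hqc₁ hpq.of_append_right hqp hxu hx

theorem exists_noReturn_of_not_isSplitting (hac : CuspAcyclic G col) (hu : ¬ IsSplitting G col u)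
    (p : List (EdgeDart V E)) :
    ∃ r w, IsPath G u r w ∧ r ≠ [] ∧ CuspFree col r ∧ NoCusp col p r ∧ NoReturn G col r w := by
  obtain ⟨l, hl, hpl⟩ : ∃ l, IsMinCycle G col u l ∧ NoCusp col p l := by
    obtain ⟨l, hl⟩ := exists_isMinCycle hu
    rcases noCusp_or_noCusp_revWalk hl.noCusp p with hpl | hpl
    exacts [⟨l, hl, hpl⟩, ⟨_, hl.revWalk, hpl⟩]
  obtain ⟨r, r', rfl, hr, hcusp⟩ := exists_first_cusp fun h => hac u l hl.toIsCycle h hl.noCusp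
  have hr₀ := ne_nil_left_of_not_noCusp hcusp
  obtain ⟨w, hrw, hrw'⟩ :=
    hl.toIsCycle.exists_isPath_of_append hr₀ (ne_nil_right_of_not_noCusp hcusp)
  exact ⟨r, w, hrw, hr₀, hr, hpl.of_append_right, hl.noReturn hac hrw hrw' hr hcusp⟩

theorem NoReturn.disjoint_srcs {r : List (EdgeDart V E)} (h : NoReturn G col p u)
    (hr : IsPath G u r w) (hrc : CuspFree col r) (hpr : NoCusp col p r) :
    (srcs p).Disjoint (srcs r) := by
  intro x hxp hxr
  obtain ⟨r₁, r₂, rfl, -, hr₁, -⟩ := hr.exists_split hxr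
  exact h r₁ x hr₁ (cuspFree_append.1 hrc).1 hpr.of_append_right hxp

theorem NoReturn.append {r : List (EdgeDart V E)} (hp : NoReturn G col p u)
    (hr : NoReturn G col r w) (hrw : IsPath G u r w) (hrc : CuspFree col r)
    (hpr : NoCusp col p r) (hr₀ : r ≠ []) : NoReturn G col (p ++ r) w := by
  intro q y hq hqc hprq hy
  have hrq := (noCusp_append_left hr₀).1 hprq
  have hyr := hr q y hq hqc hrq
  rcases List.mem_append.1 (srcs_append p r ▸ hy) with hy | hy
  · exact hp (r ++ q) y (hrw.append hq (hr.disjoint_srcs hq hqc hrq) hyr)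
      (cuspFree_append.2 ⟨hrc, hqc, hrq⟩) ((noCusp_append_right hr₀).2 hpr) hy
  · exact hyr hy

/-- **Yeo's theorem** for local colourings. Without a splitting vertex, a cusp-free path could be
prolonged forever. -/
theorem exists_isSplitting (hfin : V(G).Finite) (hne : V(G).Nonempty) (hac : CuspAcyclic G col) :
    ∃ v ∈ V(G), IsSplitting G col v := by
  by_contra! hns
  obtain ⟨v, hv⟩ := hne
  have hlong : ∀ m : ℕ, ∃ p u, u ∈ V(G) ∧ m ≤ p.length ∧ IsPath G v p u ∧ CuspFree col p ∧
      NoReturn G col p u := by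
    intro m
    induction m with
    | zero => exact ⟨[], v, hv, le_rfl, .nil, cuspFree_nil, by simp [NoReturn]⟩
    | succ m ih =>
      obtain ⟨p, u, hu, hm, hp, hpc, hpr⟩ := ih
      obtain ⟨r, w, hr, hr₀, hrc, hnc, hrr⟩ := exists_noReturn_of_not_isSplitting hac (hns u hu) p
      have hpos := List.length_pos_iff.2 hr₀
      exact ⟨p ++ r, w, hr.isWalk.end_mem hu, by rw [List.length_append]; omega,
        hp.append hr (hpr.disjoint_srcs hr hrc hnc) (hpr r w hr hrc hnc),
        cuspFree_append.2 ⟨hpc, hrc, hnc⟩, hpr.append hrr hr hrc hnc hr₀⟩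
  obtain ⟨p, u, -, hm, hp, -⟩ := hlong (hfin.toFinset.card + 1)
  have hsub : (⟨srcs p, hp.nodup_srcs⟩ : Finset V) ⊆ hfin.toFinset := fun x hx => by
    obtain ⟨d, hd, rfl⟩ := mem_srcs.1 hx
    exact hfin.mem_toFinset.2 (hp.isWalk.isLink d hd).left_mem
  have hcard : p.length ≤ hfin.toFinset.card := by
    simpa [srcs] using Finset.card_le_card hsub
  omega

end Yeo

section Pair

variable {G : Graph V E} {col : V → E → C} {K W : Set V} {u v w x : V}
  {l : List (EdgeDart V E)}

theorem IsWalk.vertex_mem (h : IsWalk G u l w) (hu : u ∈ V(G)) (hx : x ∈ w :: srcs l) :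
    x ∈ V(G) := by
  rcases List.mem_cons.1 hx with rfl | hx
  · exact h.end_mem hu
  · obtain ⟨d, hd, rfl⟩ := mem_srcs.1 hx
    exact (h.isLink d hd).left_mem

theorem IsWalk.induce (h : IsWalk G u l w) (hW : ∀ x ∈ w :: srcs l, x ∈ W) :
    IsWalk (G.induce W) u l w :=
  h.congr fun d hd => ⟨h.isLink d hd, hW _ (List.mem_cons_of_mem _ (mem_srcs.2 ⟨d, hd, rfl⟩)),
    hW _ (h.tgt_mem d hd)⟩

/-- Some walk of `G` leads from `u` to `w`; in contrast to usual connectedness, this always holds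
when `u = w`, even if `u` is no vertex of `G`. -/
def Joined (G : Graph V E) (u w : V) : Prop := ∃ l, IsWalk G u l w

theorem Joined.refl (u : V) : Joined G u u := ⟨[], rfl⟩

theorem Joined.symm (h : Joined G u w) : Joined G w u :=
  let ⟨_, hl⟩ := h
  ⟨_, hl.revWalk⟩

theorem Joined.trans (h : Joined G u v) (h' : Joined G v w) : Joined G u w :=
  let ⟨_, hl⟩ := h
  let ⟨_, hl'⟩ := h'
  ⟨_, hl.append hl'⟩

theorem Joined.mem (h : Joined G u w) (hu : u ∈ V(G)) : w ∈ V(G) :=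
  let ⟨_, hl⟩ := h
  hl.end_mem hu

theorem IsWalk.joined_induce (h : IsWalk G u l w) (hW : ∀ x ∈ w :: srcs l, x ∈ W)
    (hx : x ∈ w :: srcs l) : Joined (G.induce W) u x ∧ Joined (G.induce W) x w := by
  rcases List.mem_cons.1 hx with rfl | hx
  · exact ⟨⟨l, h.induce hW⟩, .refl _⟩
  · obtain ⟨l₁, l₂, -, -, h₁, h₂⟩ := (h.induce hW).exists_split hx
    exact ⟨⟨l₁, h₁⟩, ⟨l₂, h₂⟩⟩

theorem IsSplitting.color_eq (hv : IsSplitting (G.induce W) col v) (hvW : v ∈ W) {x x' : E}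
    {y y' : V} (hx : G.IsLink x v y) (hx' : G.IsLink x' v y') (hy : y ∈ W \ {v})
    (h : Joined (G.induce (W \ {v})) y y') : col v x = col v x' := by
  obtain ⟨l, hl⟩ := h
  obtain ⟨m, hm⟩ := hl.exists_isPath
  have hmem : ∀ z ∈ y' :: srcs m, z ∈ W \ {v} := fun z hz => hm.isWalk.vertex_mem hy hz
  have hmW : IsPath (G.induce W) y m y' :=
    ⟨hm.isWalk.congr fun d hd => ⟨(hm.isWalk.isLink d hd).1, (hm.isWalk.isLink d hd).2.1.1,
      (hm.isWalk.isLink d hd).2.2.1⟩, hm.nodup⟩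
  have hcycle := IsPath.isCycle_cons_concat (G := G.induce W) ⟨hx, hvW, hy.1⟩ hmW
    ⟨hx'.symm, (hmem y' (by simp)).1, hvW⟩ fun hvm => (hmem v hvm).2 rfl
  have hcusp := endColor_eq_startColor (hv _ hcycle)
  rw [← List.cons_append, endColor_concat] at hcusp
  exact (Option.some_injective _ hcusp).symm

/-- `W` contains the cusp-free paths between elements of `K ∩ W`. -/
def IsCuspConvex (G : Graph V E) (col : V → E → C) (K W : Set V) : Prop :=
  ∀ c ∈ K ∩ W, ∀ c' ∈ K ∩ W, ∀ l, IsPath G c l c' → CuspFree col l → ∀ x ∈ srcs l, x ∈ W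

theorem IsPath.exists_split_at (h : IsPath G u l w) (hv : v ∈ srcs l) :
    ∃ l₁ x y m, l = l₁ ++ ⟨v, x, y⟩ :: m ∧ IsPath G u l₁ v ∧ G.IsLink x v y ∧ IsWalk G y m w ∧
      v ∉ w :: srcs m := by
  obtain ⟨l₁, _ | ⟨⟨v', x, y⟩, m⟩, rfl, hne, h₁, ⟨⟨rfl, hx, hm⟩, hn⟩⟩ := h.exists_split hv
  · exact absurd rfl hne
  · exact ⟨l₁, x, y, m, rfl, h₁, hx, hm, by grind [srcs_cons]⟩

theorem IsSplitting.isCuspConvex_component (hv : IsSplitting (G.induce W) col v) (hvW : v ∈ W)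
    (hW : IsCuspConvex G col K W) (hu : u ∈ W \ {v}) :
    IsCuspConvex G col K {x | Joined (G.induce (W \ {v})) u x} := by
  rintro c ⟨hcK, hc⟩ c' ⟨hc'K, hc'⟩ l hl hlc x hx
  have hcW : c ∈ W \ {v} := hc.mem hu
  have hc'W : c' ∈ W \ {v} := hc'.mem hu
  have hlW := hW c ⟨hcK, hcW.1⟩ c' ⟨hc'K, hc'W.1⟩ l hl hlc
  by_cases hvl : v ∈ srcs l
  · exfalso
    obtain ⟨l₁, e, y, m, rfl, hl₁, he, hm, hvm⟩ := hl.exists_split_at hvl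
    obtain rfl | ⟨n, ⟨z, e', v'⟩, rfl⟩ := l₁.eq_nil_or_concat'
    · exact hcW.2 hl₁.isWalk
    obtain ⟨hn, he', rfl⟩ := isWalk_concat.1 hl₁.isWalk
    have hvn := hl₁.end_notMem
    simp only [srcs_append, srcs_cons, srcs_nil] at hlW hvn hn he'
    have hmW : ∀ x ∈ c' :: srcs m, x ∈ W \ {v'} := by grind
    have hnW : ∀ x ∈ z :: srcs n, x ∈ W \ {v'} := by grind
    have hyc' := (hm.joined_induce hmW (x := c') (by simp)).1
    have hcz := (hn.joined_induce hnW (x := z) (by simp)).1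
    have hzy := (hcz.symm.trans hc.symm).trans (hc'.trans hyc'.symm)
    have hcol := hv.color_eq hvW he'.symm he (hnW z (by simp)) hzy
    have := (cuspFree_append.1 hlc).2.2
    simp [NoCusp, hcol] at this
  · exact hc.trans (hl.isWalk.joined_induce (by grind) (by simp [hx])).1

theorem IsPath.side_eq {P : Type*} {S : E → P} (hS : ∀ ⦃u w w' x y⦄, G.IsLink x u w →
      G.IsLink y u w' → (u ∈ K → col u x = col u y) → S x = S y)
    (h : IsPath G u l w) (hK : ∀ k ∈ srcs l, k ∈ K → k = u) :
    ∀ d ∈ l, ∀ d' ∈ l, S d.edge = S d'.edge := by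
  induction l generalizing u with
  | nil => simp
  | cons d l ih =>
    obtain ⟨⟨rfl, hd, hw⟩, hn⟩ := h
    have hlK : ∀ k ∈ srcs l, k ∉ K := by grind [srcs_cons]
    have hl := ih ⟨hw, by grind [srcs_cons]⟩ fun k hk hkK => absurd hkK (hlK k hk)
    obtain _ | ⟨d₁, l⟩ := l
    · simp
    · have hd₁ : S d₁.edge = S d.edge :=
        hS (hw.1 ▸ hw.2.1) hd.symm fun hmem => absurd (hw.1 ▸ hmem) (hlK _ (by simp))
      grind

theorem IsPath.exists_side {P : Type*} {S : E → P} (hS : ∀ ⦃u w w' x y⦄, G.IsLink x u w →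
      G.IsLink y u w' → (u ∈ K → col u x = col u y) → S x = S y)
    (hjoin : ∀ c ∈ K ∩ (W \ {v}), ∀ c' ∈ K ∩ (W \ {v}),
      Joined (G.induce (W \ {v})) c c' → c = c')
    {c c' : V} (hc : c ∈ K ∩ W) (hc' : c' ∈ K ∩ (W \ {v})) (hne : c ≠ c') (hvK : v ∈ K → v = c)
    (hl : IsPath G c l c') (hlW : ∀ x ∈ srcs l, x ∈ W) :
    ∃ x y, G.IsLink x v y ∧ y ∈ W \ {v} ∧ Joined (G.induce (W \ {v})) y c' ∧
      ∀ d ∈ l, S d.edge = S x := by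
  have hvl : v ∈ srcs l := by
    by_contra hvl
    have hcl := hl.isWalk.start_mem_srcs fun hnil => hne (by subst hnil; exact hl.isWalk)
    have hcc' := (hl.isWalk.joined_induce (W := W \ {v}) (by grind) (x := c) (by simp [hcl])).2
    exact hne (hjoin c (by grind) c' hc' hcc')
  obtain ⟨l₁, x, y, m, rfl, hl₁, hx, hm, hvm⟩ := hl.exists_split_at hvl
  have hl₁n := hl₁.end_notMem
  have hn := hl.nodup
  simp only [srcs_append, srcs_cons, List.nodup_cons, List.nodup_append'] at hlW hn
  have hmW : ∀ x ∈ c' :: srcs m, x ∈ W \ {v} := by grind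
  have hyc' : Joined (G.induce (W \ {v})) y c' := (hm.joined_induce hmW (by simp)).1
  have hK : ∀ k ∈ srcs (l₁ ++ ⟨v, x, y⟩ :: m), k ∈ K → k = c := by
    intro k hk hkK
    rcases List.mem_append.1 (srcs_append _ _ ▸ hk) with hk | hk
    · obtain ⟨r, r', rfl, hr', hr, -⟩ := hl₁.exists_split hk
      have hcl := hl₁.isWalk.start_mem_srcs (by simp [hr'])
      have hck := (hr.isWalk.joined_induce (W := W \ {v}) (x := k) (by grind [srcs_append])
        (by simp)).1
      exact (hjoin c (by grind) k (by grind) hck).symm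
    rcases List.mem_cons.1 (srcs_cons _ _ ▸ hk) with rfl | hk
    · exact hvK hkK
    · have hkc' := (hm.joined_induce hmW (x := k) (by simp [hk])).2
      have := hjoin k (by grind) c' hc' hkc'
      grind
  exact ⟨x, y, hx, hyc'.symm.mem hc'.2, hyc',
    fun d hd => hl.side_eq hS hK d hd ⟨v, x, y⟩ (by simp)⟩

/-- By Yeo's theorem, a smallest set which contains two elements of `K`, and all cusp-free paths
between those it contains, has a splitting vertex; the paths have to go through it, and leave it by
edges of a single colour. -/
theorem CuspAcyclic.exists_pair {P : Type*} {S : E → P} (hac : CuspAcyclic G col)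
    (hfin : V(G).Finite) (hK : (K ∩ V(G)).Nontrivial)
    (hS : ∀ ⦃u w w' x y⦄, G.IsLink x u w → G.IsLink y u w' → (u ∈ K → col u x = col u y) →
      S x = S y) :
    ∃ c ∈ K, ∃ c' ∈ K, c ≠ c' ∧ ∀ l, IsPath G c l c' → CuspFree col l →
      ∀ l', IsPath G c l' c' → CuspFree col l' → ∀ d ∈ l, ∀ d' ∈ l', S d.edge = S d'.edge := by
  have hVG : IsCuspConvex G col K V(G) := fun c hc _ _ l hl _ x hx =>
    hl.isWalk.vertex_mem hc.2 (List.mem_cons_of_mem _ hx)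
  obtain ⟨W, ⟨hWG, hWconv, hWK⟩, hmin⟩ :=
    (hfin.finite_subsets.subset (t := {W | W ⊆ V(G) ∧ IsCuspConvex G col K W ∧
      (K ∩ W).Nontrivial}) fun _ hW => hW.1).exists_minimal ⟨V(G), subset_rfl, hVG, hK⟩
  obtain ⟨v, hvW, hv⟩ := exists_isSplitting (G := G.induce W) (hfin.subset hWG)
    (hWK.nonempty.mono Set.inter_subset_right) (hac.mono (Graph.induce_le hWG))
  have hjoin : ∀ c ∈ K ∩ (W \ {v}), ∀ c' ∈ K ∩ (W \ {v}),
      Joined (G.induce (W \ {v})) c c' → c = c' := by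
    intro c hc c' hc' hcc'
    by_contra hne
    have hsub : {x | Joined (G.induce (W \ {v})) c x} ⊆ W \ {v} := fun x hx => hx.mem hc.2
    have hWsub := hmin ⟨(hsub.trans Set.sdiff_subset).trans hWG,
      hv.isCuspConvex_component hvW hWconv hc.2, c, ⟨hc.1, .refl c⟩, c', ⟨hc'.1, hcc'⟩, hne⟩
      (hsub.trans Set.sdiff_subset)
    exact (hsub (hWsub hvW)).2 rfl
  obtain ⟨c, hc, c', hc', hne, hvK⟩ :
      ∃ c ∈ K ∩ W, ∃ c' ∈ K ∩ (W \ {v}), c ≠ c' ∧ (v ∈ K → v = c) := by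
    by_cases hvK : v ∈ K
    · obtain ⟨c', hc', hne⟩ := hWK.exists_ne v
      exact ⟨v, ⟨hvK, hvW⟩, c', ⟨hc'.1, hc'.2, hne⟩, hne.symm, fun _ => rfl⟩
    · obtain ⟨c, hc, c', hc', hne⟩ := hWK
      exact ⟨c, hc, c', ⟨hc'.1, hc'.2, fun h => hvK (h ▸ hc'.1)⟩, hne, fun h => absurd h hvK⟩
  refine ⟨c, hc.1, c', hc'.1, hne, fun l hl hlc l' hl' hlc' d hd d' hd' => ?_⟩
  have hc'W : c' ∈ K ∩ W := ⟨hc'.1, hc'.2.1⟩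
  obtain ⟨x, y, hx, hy, hyc', hSx⟩ :=
    hl.exists_side hS hjoin hc hc' hne hvK (hWconv c hc c' hc'W l hl hlc)
  obtain ⟨x', y', hx', -, hyc'', hSx'⟩ :=
    hl'.exists_side hS hjoin hc hc' hne hvK (hWconv c hc c' hc'W l' hl' hlc')
  have hcol := hv.color_eq hvW hx hx' hy (hyc'.trans hyc''.symm)
  rw [hSx d hd, hSx' d' hd']
  exact hS hx hx' fun _ => hcol

end Pair

end EdgeDart

/-- The nodes and edges which take part in a `⊗/⅋`-step, named as in `NetGraph.TensorParStep`. -/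
structure Redex (V E : Type*) where
  (c t p : V)
  (e f a b a' b' : E)
  (c₁ c₂ : V)

/-- Both binary connectives read from right to left. -/
def Redex.swap {V E : Type*} (X : Redex V E) : Redex V E :=
  { X with a := X.b, b := X.a, a' := X.b', b' := X.a', c₁ := X.c₂, c₂ := X.c₁ }

namespace EdgeDart

open scoped Graph

variable {V E C : Type*}

section Expansion

variable {G G' : Graph V E} {col : V → E → C} {X : Redex V E} {u v w x y z : V} {x' : E}
  {l m : List (EdgeDart V E)}

/-- The graph `G'` arises from `G` by replacing the cuts `c₁` and `c₂` by the cut `c` between the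
`⊗`-node `t` and the `⅋`-node `p`; the colouring `col` serves for both graphs. -/
structure IsExpansion (X : Redex V E) (G G' : Graph V E) (col : V → E → C) : Prop where
  fresh : ∀ v ∈ V(G), v ≠ X.c ∧ v ≠ X.t ∧ v ≠ X.p
  removed : ∀ v ∈ V(G'), v ≠ X.c₁ ∧ v ≠ X.c₂
  link_c : ∀ x w, G'.IsLink x X.c w → (x = X.e ∧ w = X.t) ∨ (x = X.f ∧ w = X.p)
  link_t : ∀ x w, G'.IsLink x X.t w → (x = X.a ∧ G.IsLink X.a X.c₁ w) ∨
    (x = X.b ∧ G.IsLink X.b X.c₂ w) ∨ (x = X.e ∧ w = X.c)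
  link_p : ∀ x w, G'.IsLink x X.p w → (x = X.a' ∧ G.IsLink X.a' X.c₁ w) ∨
    (x = X.b' ∧ G.IsLink X.b' X.c₂ w) ∨ (x = X.f ∧ w = X.c)
  link_old : ∀ x u w, G'.IsLink x u w → u ≠ X.c → u ≠ X.t → u ≠ X.p → w ≠ X.c → w ≠ X.t →
    w ≠ X.p → G.IsLink x u w
  color_p : col X.p X.a' = col X.p X.b'
  color_c₁ : col X.c₁ X.a ≠ col X.c₁ X.a'
  color_c₂ : col X.c₂ X.b ≠ col X.c₂ X.b'
  c_ne_t : X.c ≠ X.t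
  c₁_ne_c₂ : X.c₁ ≠ X.c₂

theorem IsExpansion.swap (h : IsExpansion X G G' col) : IsExpansion X.swap G G' col where
  fresh := h.fresh
  removed v hv := (h.removed v hv).symm
  link_c := h.link_c
  link_t x w hx := by have := h.link_t x w hx; tauto
  link_p x w hx := by have := h.link_p x w hx; tauto
  link_old := h.link_old
  color_p := h.color_p.symm
  color_c₁ := h.color_c₂
  color_c₂ := h.color_c₁
  c_ne_t := h.c_ne_t
  c₁_ne_c₂ := h.c₁_ne_c₂.symm

theorem IsExpansion.not_isLink_t (h : IsExpansion X G G' col) (x : E) :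
    ¬ G'.IsLink x X.t X.t := by
  intro hx
  rcases h.link_t x X.t hx with ⟨-, ha⟩ | ⟨-, hb⟩ | ⟨-, hc⟩
  · exact (h.fresh X.t ha.right_mem).2.1 rfl
  · exact (h.fresh X.t hb.right_mem).2.1 rfl
  · exact h.c_ne_t hc.symm

theorem IsExpansion.isLink (h : IsExpansion X G G' col) (hw : IsWalk G' u l w)
    (hold : ∀ x ∈ w :: srcs l, x ≠ X.c ∧ x ≠ X.t ∧ x ≠ X.p) :
    ∀ d ∈ l, G.IsLink d.edge d.src d.tgt := by
  intro d hd
  have hsrc := hold d.src (List.mem_cons_of_mem _ (mem_srcs.2 ⟨d, hd, rfl⟩))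
  have htgt := hold d.tgt (hw.tgt_mem d hd)
  exact h.link_old _ _ _ (hw.isLink d hd) hsrc.1 hsrc.2.1 hsrc.2.2 htgt.1 htgt.2.1 htgt.2.2

/-- The walk `l` enters and leaves the vertex `x` by edges of distinct colours. -/
def Crosses (col : V → E → C) (l : List (EdgeDart V E)) (x : V) : Prop :=
  ∃ d ∈ l, ∃ d' ∈ l, d.tgt = x ∧ d'.src = x ∧ col x d.edge ≠ col x d'.edge

theorem crosses_of_append (hw : IsWalk G u l x) (hw' : IsWalk G x m w) (hl : l ≠ []) (hm : m ≠ [])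
    (hnc : NoCusp col l m) : Crosses col (l ++ m) x := by
  obtain ⟨l, d, rfl⟩ := l.eq_nil_or_concat'.resolve_left hl
  obtain ⟨d', m, rfl⟩ := List.exists_cons_of_ne_nil hm
  obtain rfl := (isWalk_concat.1 hw).2.2
  refine ⟨d, by simp, d', by simp, rfl, hw'.1, ?_⟩
  simpa [NoCusp, hw'.1, eq_comm] using hnc

theorem IsPath.crosses (h : IsPath G u l w) (hc : CuspFree col l) (hx : x ∈ srcs l)
    (hxu : x ≠ u) : Crosses col l x := by
  obtain ⟨l₁, l₂, rfl, hl₂, h₁, h₂⟩ := h.exists_split hx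
  have hl₁ : l₁ ≠ [] := by
    rintro rfl
    exact hxu h₁.isWalk.symm
  exact crosses_of_append h₁.isWalk h₂.isWalk hl₁ hl₂ (cuspFree_append.1 hc).2.2

theorem IsCycle.exists_rotate (h : IsCycle G v l) (hc : CuspFree col l) (hnc : NoCusp col l l)
    (hx : x ∈ srcs l) :
    ∃ l', l'.Perm l ∧ IsCycle G x l' ∧ CuspFree col l' ∧ NoCusp col l' l' := by
  obtain ⟨l₁, l₂, rfl, hl₂, h₁, h₂⟩ := h.isWalk.exists_split hx
  rcases eq_or_ne l₁ [] with rfl | hl₁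
  · exact ⟨l₂, by simp, (show v = x from h₁) ▸ h, hc, hnc⟩
  · obtain ⟨hc₁, hc₂, hc₁₂⟩ := cuspFree_append.1 hc
    rw [noCusp_append_left hl₂, noCusp_append_right hl₁] at hnc
    refine ⟨l₂ ++ l₁, List.perm_append_comm, ⟨h₂.append h₁, ?_, by simp [hl₂]⟩,
      cuspFree_append.2 ⟨hc₂, hc₁, hnc⟩, ?_⟩
    · exact (List.perm_append_comm.map src).nodup_iff.1 h.nodup
    · rwa [noCusp_append_left hl₁, noCusp_append_right hl₂]

theorem IsCycle.crosses (h : IsCycle G v l) (hc : CuspFree col l) (hnc : NoCusp col l l)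
    (hx : x ∈ srcs l) : Crosses col l x := by
  obtain ⟨l', hperm, ⟨hw, -, hl'⟩, -, hnc'⟩ := h.exists_rotate hc hnc hx
  obtain ⟨d, hd, d', hd', hcross⟩ := crosses_of_append hw hw hl' hl' hnc'
  exact ⟨d, by simpa [hperm.mem_iff] using hd, d', by simpa [hperm.mem_iff] using hd', hcross⟩

theorem IsExpansion.not_crosses_c (h : IsExpansion X G G' col) (hw : IsWalk G' u l w)
    (ht : X.t ∉ w :: srcs l) : ¬ Crosses col l X.c := by
  rintro ⟨d, hd, d', hd', hdc, hd'c, hne⟩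
  have hdt : d.src ≠ X.t := fun hdt => ht (List.mem_cons_of_mem _ (mem_srcs.2 ⟨d, hd, hdt⟩))
  have hd't : d'.tgt ≠ X.t := fun hd't => ht (hd't ▸ hw.tgt_mem d' hd')
  have hlink := h.link_c _ _ (hdc ▸ (hw.isLink d hd).symm)
  have hlink' := h.link_c _ _ (hd'c ▸ hw.isLink d' hd')
  grind

theorem IsExpansion.not_crosses_p (h : IsExpansion X G G' col) (hw : IsWalk G' u l w)
    (hc : X.c ∉ w :: srcs l) : ¬ Crosses col l X.p := by
  rintro ⟨d, hd, d', hd', hdp, hd'p, hne⟩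
  have hdc : d.src ≠ X.c := fun hdc => hc (List.mem_cons_of_mem _ (mem_srcs.2 ⟨d, hd, hdc⟩))
  have hd'c : d'.tgt ≠ X.c := fun hd'c => hc (hd'c ▸ hw.tgt_mem d' hd')
  have hlink := h.link_p _ _ (hdp ▸ (hw.isLink d hd).symm)
  have hlink' := h.link_p _ _ (hd'p ▸ hw.isLink d' hd')
  have := h.color_p
  grind

theorem cuspFree_cons_concat_congr {x x' : E} (v w v' w' : V) :
    CuspFree col (⟨v, x, y⟩ :: (m ++ [⟨z, x', w⟩])) ↔
      CuspFree col (⟨v', x, y⟩ :: (m ++ [⟨z, x', w'⟩])) := by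
  simp [cuspFree_cons, cuspFree_append, NoCusp, startColor_append]

/-- A path of `G'` which leaves `t` along `a` and comes back to `t` or `p` becomes a path of `G`
when `t` and `p` are contracted to `c₁` and `c₂`. -/
theorem IsExpansion.not_cuspFree_of_old (h : IsExpansion X G G' col) (hac : CuspAcyclic G col)
    (hgood : ∀ l, IsPath G X.c₁ l X.c₂ → CuspFree col l → ∀ d ∈ l, d.edge ≠ X.a)
    (hy : G.IsLink X.a X.c₁ y) (hm : IsPath G' y m z) (hz : z ∈ V(G'))
    (hold : ∀ x ∈ z :: srcs m, x ≠ X.c ∧ x ≠ X.t ∧ x ≠ X.p)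
    (hx' : (x' = X.b ∧ G.IsLink X.b X.c₂ z) ∨ (x' = X.a' ∧ G.IsLink X.a' X.c₁ z) ∨
      (x' = X.b' ∧ G.IsLink X.b' X.c₂ z)) :
    ¬ CuspFree col (⟨v, X.a, y⟩ :: (m ++ [⟨z, x', w⟩])) := by
  intro hcf
  have hmG : IsPath G y m z := ⟨hm.isWalk.congr (h.isLink hm.isWalk hold), hm.nodup⟩
  have hmem : ∀ x ∈ z :: srcs m, x ∈ V(G') := by
    rintro x (_ | ⟨_, hx⟩)
    · exact hz
    · obtain ⟨d, hd, rfl⟩ := mem_srcs.1 hx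
      exact (hm.isWalk.isLink d hd).left_mem
  have hc₁ : X.c₁ ∉ z :: srcs m := fun hmem₁ => (h.removed _ (hmem _ hmem₁)).1 rfl
  have hc₂ : X.c₂ ∉ z :: srcs m := fun hmem₂ => (h.removed _ (hmem _ hmem₂)).2 rfl
  have hpath : ¬ G.IsLink x' X.c₂ z := fun hlink =>
    hgood _ (IsPath.cons_concat hy hmG hlink.symm hc₁ hc₂ h.c₁_ne_c₂)
      ((cuspFree_cons_concat_congr v w _ _).1 hcf) _ (List.mem_cons_self ..) rfl
  rcases hx' with ⟨rfl, hx'⟩ | ⟨rfl, hx'⟩ | ⟨rfl, hx'⟩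
  · exact hpath hx'
  · refine hac X.c₁ _ (IsPath.isCycle_cons_concat hy hmG hx'.symm hc₁)
      ((cuspFree_cons_concat_congr v w _ _).1 hcf) ?_
    rw [← List.cons_append, noCusp_append_left (by simp), List.cons_append, noCusp_singleton_cons]
    exact h.color_c₁.symm
  · exact hpath hx'

theorem IsExpansion.forall_ne_of_ends (h : IsExpansion X G G' col) (hm : IsPath G' y m z)
    (hcf : CuspFree col m) (hy : y ∈ V(G)) (ht : X.t ∉ z :: srcs m) (hzc : z ≠ X.c)
    (hzp : z ≠ X.p) : ∀ x ∈ z :: srcs m, x ≠ X.c ∧ x ≠ X.t ∧ x ≠ X.p := by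
  obtain ⟨hyc, -, hyp⟩ := h.fresh y hy
  have hc : X.c ∉ z :: srcs m := fun hc =>
    h.not_crosses_c hm.isWalk ht
      (hm.crosses hcf ((List.mem_cons.1 hc).resolve_left hzc.symm) hyc.symm)
  have hp : X.p ∉ z :: srcs m := fun hp =>
    h.not_crosses_p hm.isWalk hc
      (hm.crosses hcf ((List.mem_cons.1 hp).resolve_left hzp.symm) hyp.symm)
  exact fun x hx => ⟨ne_of_mem_of_not_mem hx hc, ne_of_mem_of_not_mem hx ht,
    ne_of_mem_of_not_mem hx hp⟩

theorem IsExpansion.exists_eq_concat_concat (h : IsExpansion X G G' col)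
    (hm : IsPath G' y m X.c) (hy : y ∈ V(G)) (ht : X.t ∉ srcs m) :
    ∃ n z x', m = n ++ [⟨z, x', X.p⟩] ++ [⟨X.p, X.f, X.c⟩] ∧ IsPath G' y n z ∧
      (∀ x ∈ z :: srcs n, x ≠ X.c ∧ x ≠ X.t ∧ x ≠ X.p) ∧
      ((x' = X.a' ∧ G.IsLink X.a' X.c₁ z) ∨ (x' = X.b' ∧ G.IsLink X.b' X.c₂ z)) := by
  obtain ⟨hyc, -, hyp⟩ := h.fresh y hy
  obtain ⟨hw, hnodup⟩ := hm
  rcases m.eq_nil_or_concat' with rfl | ⟨m, ⟨p, f, c⟩, rfl⟩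
  · exact absurd hw hyc
  obtain ⟨hw, hlink, rfl : c = X.c⟩ := isWalk_concat.1 hw
  simp only [srcs_append, srcs_cons, srcs_nil, List.mem_append, List.mem_singleton,
    not_or] at ht hnodup
  obtain ⟨rfl, rfl⟩ := (h.link_c f p hlink.symm).resolve_left fun he => ht.2 he.2.symm
  rcases m.eq_nil_or_concat' with rfl | ⟨n, ⟨z, x', p⟩, rfl⟩
  · exact absurd hw hyp
  obtain ⟨hw, hlink, rfl : p = X.p⟩ := isWalk_concat.1 hw
  refine ⟨n, z, x', rfl, ⟨hw, ?_⟩, ?_, ?_⟩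
  · grind [srcs_append, srcs_cons, srcs_nil]
  · grind [srcs_append, srcs_cons, srcs_nil]
  · rcases h.link_p x' z hlink.symm with ha | hb | hc
    · exact .inl ha
    · exact .inr hb
    · grind [srcs_append, srcs_cons, srcs_nil]

theorem IsExpansion.not_isLink_c₁ (h : IsExpansion X G G' col) (hac : CuspAcyclic G col)
    (hgood : ∀ l, IsPath G X.c₁ l X.c₂ → CuspFree col l → ∀ d ∈ l, d.edge ≠ X.a)
    {d : EdgeDart V E} (hl : IsCycle G' X.t (d :: l)) (hc : CuspFree col (d :: l))
    (hnc : NoCusp col (d :: l) (d :: l)) : ¬ (d.edge = X.a ∧ G.IsLink X.a X.c₁ d.tgt) := by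
  rintro ⟨hd, hy⟩
  obtain ⟨x, y, m, z, x', heq, hlink, hm, hlink', htm⟩ :=
    hl.exists_eq_cons_concat h.not_isLink_t
  obtain ⟨rfl, rfl⟩ := List.cons.inj heq
  obtain rfl : x = X.a := hd
  have hcm : CuspFree col m := (cuspFree_append.1 (cuspFree_cons.1 hc).2).1
  have hz : z ∈ V(G') := hlink'.left_mem
  rcases h.link_t x' z hlink'.symm with ⟨rfl, -⟩ | ⟨rfl, hb⟩ | ⟨rfl, rfl⟩
  · rw [← List.cons_append, noCusp_append_left (by simp), List.cons_append,
      noCusp_singleton_cons] at hnc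
    exact hnc rfl
  · obtain ⟨hzc, -, hzp⟩ := h.fresh z hb.right_mem
    exact h.not_cuspFree_of_old hac hgood hy hm hz
      (h.forall_ne_of_ends hm hcm hy.right_mem htm hzc hzp) (.inl ⟨rfl, hb⟩) hc
  · obtain ⟨n, z, x', rfl, hn, hold, hx'⟩ := h.exists_eq_concat_concat hm hy.right_mem
      fun ht => htm (List.mem_cons_of_mem _ ht)
    refine h.not_cuspFree_of_old (v := X.t) (w := X.p) hac hgood hy hn ?_ hold (.inr hx') ?_
    · exact (hm.isWalk.isLink ⟨z, x', X.p⟩ (by simp)).left_mem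
    · rw [List.append_assoc (n ++ _), ← List.cons_append] at hc
      exact (cuspFree_append.1 hc).1

theorem IsExpansion.edge_eq_e (h : IsExpansion X G G' col) (hac : CuspAcyclic G col)
    (hgood : ∀ l, IsPath G X.c₁ l X.c₂ → CuspFree col l →
      ∀ d ∈ l, d.edge ≠ X.a ∧ d.edge ≠ X.b)
    {d : EdgeDart V E} (hl : IsCycle G' X.t (d :: l)) (hc : CuspFree col (d :: l))
    (hnc : NoCusp col (d :: l) (d :: l)) : d.edge = X.e := by
  rcases h.link_t d.edge d.tgt (hl.isWalk.1 ▸ hl.isWalk.2.1) with ha | hb | he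
  · exact absurd ha (h.not_isLink_c₁ hac (fun l hl hcf d hd => (hgood l hl hcf d hd).1) hl hc hnc)
  · refine absurd hb (h.swap.not_isLink_c₁ hac (fun l hl hcf d hd => ?_) hl hc hnc)
    exact (hgood _ hl.revWalk hcf.revWalk d.rev (by simpa [mem_revWalk] using hd)).2
  · exact he.1

theorem IsExpansion.not_isCycle_t (h : IsExpansion X G G' col) (hac : CuspAcyclic G col)
    (hgood : ∀ l, IsPath G X.c₁ l X.c₂ → CuspFree col l →
      ∀ d ∈ l, d.edge ≠ X.a ∧ d.edge ≠ X.b)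
    (hl : IsCycle G' X.t l) (hc : CuspFree col l) : ¬ NoCusp col l l := by
  intro hnc
  obtain ⟨x, y, m, z, x', rfl, -⟩ := hl.exists_eq_cons_concat h.not_isLink_t
  have hx : x = X.e := h.edge_eq_e hac hgood hl hc hnc
  have hrev : EdgeDart.revWalk (⟨X.t, x, y⟩ :: (m ++ [⟨z, x', X.t⟩])) =
      ⟨X.t, x', z⟩ :: EdgeDart.revWalk (⟨X.t, x, y⟩ :: m) := by simp [rev]
  have hx' : x' = X.e := h.edge_eq_e hac hgood (hrev ▸ hl.revWalk) (hrev ▸ hc.revWalk)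
    (hrev ▸ hnc.revWalk)
  rw [← List.cons_append, noCusp_append_left (by simp), List.cons_append,
    noCusp_singleton_cons, hx, hx'] at hnc
  exact hnc rfl

theorem IsExpansion.cuspAcyclic (h : IsExpansion X G G' col) (hac : CuspAcyclic G col)
    (hgood : ∀ l, IsPath G X.c₁ l X.c₂ → CuspFree col l →
      ∀ d ∈ l, d.edge ≠ X.a ∧ d.edge ≠ X.b) :
    CuspAcyclic G' col := by
  intro v l hl hc hnc
  by_cases ht : X.t ∈ srcs l
  · obtain ⟨l', -, hl', hc', hnc'⟩ := hl.exists_rotate hc hnc ht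
    exact h.not_isCycle_t hac hgood hl' hc' hnc'
  · have hv : v ∈ srcs l := hl.isWalk.start_mem_srcs hl.ne_nil
    have htl : X.t ∉ v :: srcs l := by grind
    have hcl : X.c ∉ srcs l := fun hcl => h.not_crosses_c hl.isWalk htl (hl.crosses hc hnc hcl)
    have hpl : X.p ∉ srcs l := fun hpl =>
      h.not_crosses_p hl.isWalk (by grind) (hl.crosses hc hnc hpl)
    exact hac v l ⟨hl.isWalk.congr (h.isLink hl.isWalk (by grind)), hl.nodup, hl.ne_nil⟩ hc hnc

end Expansion

section Cyclic

variable {G : Graph V E} {col col' : V → E → C} {u w : V} {k : ℕ}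

theorem isChain_ofFn_cyclic {A : Type*} {P : A → A → Prop} {g : Fin (k + 1) → A} :
    ((List.ofFn g).IsChain P ∧ P (g (Fin.last k)) (g 0)) ↔ ∀ i, P (g i) (g (i + 1)) := by
  rw [List.isChain_ofFn]
  constructor
  · rintro ⟨hchain, hlast⟩ i
    rcases eq_or_ne i (Fin.last k) with rfl | hi
    · rwa [Fin.last_add_one]
    · have hval := Fin.val_add_one_of_lt (Fin.lt_last_iff_ne_last.2 hi)
      have hik : i.1 + 1 < k + 1 := hval ▸ (i + 1).2
      rw [show i + 1 = ⟨i.1 + 1, hik⟩ from Fin.ext hval]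
      exact hchain i.1 hik
  · refine fun h => ⟨fun i hi => ?_, by simpa using h (Fin.last k)⟩
    have hval := Fin.val_add_one_of_lt (i := (⟨i, by omega⟩ : Fin (k + 1)))
      (Fin.lt_def.2 (by simp; omega))
    rw [show (⟨i + 1, hi⟩ : Fin (k + 1)) = ⟨i, by omega⟩ + 1 from Fin.ext hval.symm]
    exact h _

theorem isWalk_iff_isChain {l : List (EdgeDart V E)} (hl : l ≠ []) :
    IsWalk G u l w ↔ l.IsChain (fun d₁ d₂ => d₁.tgt = d₂.src) ∧
      (∀ d ∈ l, G.IsLink d.edge d.src d.tgt) ∧ (l.head hl).src = u ∧ (l.getLast hl).tgt = w := by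
  induction l generalizing u with
  | nil => exact absurd rfl hl
  | cons d l ih =>
    cases l with
    | nil => simp [isWalk_singleton, and_left_comm]
    | cons d' l =>
      rw [IsWalk, ih (List.cons_ne_nil _ _), List.isChain_cons_cons, List.getLast_cons_cons,
        List.forall_mem_cons (a := d), List.head_cons, List.head_cons]
      grind

theorem isWalk_ofFn {g : Fin (k + 1) → EdgeDart V E} (hu : (g 0).src = u) :
    IsWalk G u (List.ofFn g) u ↔
      (∀ i, (g i).tgt = (g (i + 1)).src) ∧ ∀ i, G.IsLink (g i).edge (g i).src (g i).tgt := by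
  have hl : List.ofFn g ≠ [] := by simp
  rw [← isChain_ofFn_cyclic (P := fun d₁ d₂ : EdgeDart V E => d₁.tgt = d₂.src),
    isWalk_iff_isChain hl, List.forall_mem_ofFn_iff, List.head_ofFn, List.getLast_ofFn]
  subst hu
  exact ⟨fun ⟨hchain, hlink, _, hlast⟩ => ⟨⟨hchain, hlast⟩, hlink⟩,
    fun ⟨⟨hchain, hlast⟩, hlink⟩ => ⟨hchain, hlink, rfl, hlast⟩⟩

theorem cuspFree_ofFn_and_noCusp {g : Fin (k + 1) → EdgeDart V E} :
    CuspFree col (List.ofFn g) ∧ NoCusp col (List.ofFn g) (List.ofFn g) ↔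
      ∀ i, col (g i).tgt (g i).edge ≠ col (g (i + 1)).src (g (i + 1)).edge := by
  have hl : List.ofFn g ≠ [] := by simp
  rw [← isChain_ofFn_cyclic
    (P := fun d₁ d₂ : EdgeDart V E => col d₁.tgt d₁.edge ≠ col d₂.src d₂.edge), NoCusp, endColor,
    startColor, List.getLast?_eq_some_getLast hl, List.head?_eq_some_head hl, List.getLast_ofFn,
    List.head_ofFn]
  refine and_congr_right fun _ => ?_
  simp only [Option.map_some, Option.mem_some_iff, forall_eq']
  exact ne_comm

theorem cuspAcyclic_iff : CuspAcyclic G col ↔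
    ∀ (k : ℕ) (v : Fin (k + 1) → V) (x : Fin (k + 1) → E), Function.Injective v →
      (∀ i, G.IsLink (x i) (v i) (v (i + 1))) →
        ∃ i, col (v (i + 1)) (x i) = col (v (i + 1)) (x (i + 1)) := by
  constructor
  · intro h k v x hv hx
    let g : Fin (k + 1) → EdgeDart V E := fun i => ⟨v i, x i, v (i + 1)⟩
    by_contra! hne
    have hcusp := cuspFree_ofFn_and_noCusp (g := g).2 hne
    have hw : IsWalk G (v 0) (List.ofFn g) (v 0) :=
      (isWalk_ofFn (g := g) rfl).2 ⟨fun _ => rfl, hx⟩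
    refine h (v 0) (List.ofFn g) ⟨hw, ?_, by simp⟩ hcusp.1 hcusp.2
    rw [srcs, List.map_ofFn]
    exact List.nodup_ofFn.2 hv
  · intro h v l hl hc hnc
    obtain ⟨k, g, rfl⟩ : ∃ k, ∃ g : Fin (k + 1) → EdgeDart V E, l = List.ofFn g := by
      obtain ⟨d, l, rfl⟩ := List.exists_cons_of_ne_nil hl.ne_nil
      exact ⟨l.length, (d :: l).get, (List.ofFn_get _).symm⟩
    obtain rfl : (g 0).src = v := by
      simpa using ((isWalk_iff_isChain hl.ne_nil).1 hl.isWalk).2.2.1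
    obtain ⟨htgt, hlink⟩ := (isWalk_ofFn rfl).1 hl.isWalk
    have hinj : Function.Injective (src ∘ g) := by
      simpa only [srcs, List.map_ofFn, List.nodup_ofFn] using hl.nodup
    obtain ⟨i, hi⟩ := h k (src ∘ g) (edge ∘ g) hinj fun i => by
      simpa only [Function.comp_apply, ← htgt] using hlink i
    exact cuspFree_ofFn_and_noCusp.1 ⟨hc, hnc⟩ i (by rw [htgt]; exact hi)

theorem CuspAcyclic.congr (h : CuspAcyclic G col) (hcol : ∀ v ∈ V(G), ∀ x, col v x = col' v x) :
    CuspAcyclic G col' := by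
  rw [cuspAcyclic_iff] at h ⊢
  intro k v x hv hx
  obtain ⟨i, hi⟩ := h k v x hv hx
  exact ⟨i, by simpa only [hcol _ (hx i).right_mem] using hi⟩

theorem CuspFree.congr {l : List (EdgeDart V E)} (h : CuspFree col l) (hw : IsWalk G u l w)
    (hcol : ∀ v ∈ V(G), ∀ x, col v x = col' v x) : CuspFree col' l := by
  refine List.IsChain.imp_of_mem_imp (fun d₁ d₂ hd₁ hd₂ hne => ?_) h
  rwa [← hcol _ (hw.isLink d₁ hd₁).right_mem, ← hcol _ (hw.isLink d₂ hd₂).left_mem]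

end Cyclic

end EdgeDart

theorem MLLFormula.dual_dual {α : Type*} (A : MLLFormula α) : A.dual.dual = A := by
  induction A <;> simp_all only [MLLFormula.dual]

theorem NodeLabel.Typing.cut_inv {α : Type*} {Γ Δ : List (MLLFormula α)}
    (h : NodeLabel.Typing .cut Γ Δ) : ∃ A, Γ = [A, A.dual] ∧ Δ = [] := by
  cases h with
  | cut A => exact ⟨A, rfl, rfl⟩

namespace NetGraph

open EdgeDart

variable {α ν ε : Type*} {M N : NetGraph α ν ε}

open Classical in
/-- The colour of an edge at a node: the premises of a `par`-node or of a contraction-node share the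
colour `none`, every other edge has a colour of its own. -/
noncomputable def portColor (N : NetGraph α ν ε) (v : ν) (x : ε) : Option ε :=
  if (N.label v = .par ∨ N.label v = .contr) ∧ x ∈ N.prems v then none else some x

theorem portColor_eq_iff {v : ν} {x y : ε} : N.portColor v x = N.portColor v y ↔
    x = y ∨ ((N.label v = .par ∨ N.label v = .contr) ∧ x ∈ N.prems v ∧ y ∈ N.prems v) := by
  unfold portColor
  split_ifs <;> grind

theorem IsTyped.endpoints_eq (hN : N.IsTyped) {x : ε} {v w v' w' : ν} (h : N.Joins x v w)
    (h' : N.Joins x v' w') : v = v' ∧ w = w' ∨ v = w' ∧ w = v' := by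
  obtain ⟨hv, hw, h⟩ := h
  obtain ⟨hv', hw', h'⟩ := h'
  have hprems := hN.prems_unique
  have hconcls := hN.concls_unique
  grind

theorem IsTyped.eq_or_eq_of_mem_prems (hN : N.IsTyped) {x : ε} {u v w : ν} (h : N.Joins x v w)
    (hu : u ∈ N.nodes) (hx : x ∈ N.prems u) : u = v ∨ u = w := by
  obtain ⟨hv, hw, h | h⟩ := h
  · exact .inr (hN.prems_unique _ hu _ hw _ hx h.2)
  · exact .inl (hN.prems_unique _ hu _ hv _ hx h.2)

/-- The undirected multigraph underlying a typed graph; its edges are the non-pending ones. -/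
def IsTyped.toGraph (hN : N.IsTyped) : Graph ν ε where
  vertexSet := N.nodes
  IsLink := N.Joins
  isLink_symm _ _ := ⟨fun _ _ ⟨hv, hw, hx⟩ => ⟨hw, hv, hx.symm⟩⟩
  eq_or_eq_of_isLink_of_isLink _ _ _ _ _ h h' := by
    have := hN.endpoints_eq h h'
    tauto
  left_mem_of_isLink _ _ _ h := h.1

theorem IsCorrect.cuspAcyclic (hN : N.IsTyped) (hc : N.IsCorrect) :
    CuspAcyclic hN.toGraph N.portColor := by
  refine cuspAcyclic_iff.2 fun k v x hv hx => ?_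
  by_cases hx' : Function.Injective x
  · obtain ⟨w, hw, hlabel, i, j, hij, hi, hj⟩ := hc k v x ⟨hv, hx', hx⟩
    have hturn : ∀ i j, x i ∈ N.prems w → x j ∈ N.prems w → w = v (i + 1) → w = v j →
        ∃ i, N.portColor (v (i + 1)) (x i) = N.portColor (v (i + 1)) (x (i + 1)) := by
      rintro i j hi hj rfl hvj
      obtain rfl := hv hvj
      exact ⟨i, portColor_eq_iff.2 (.inr ⟨hlabel, hi, hj⟩)⟩
    rcases hN.eq_or_eq_of_mem_prems (hx i) hw hi with hi' | hi' <;>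
      rcases hN.eq_or_eq_of_mem_prems (hx j) hw hj with hj' | hj'
    · exact absurd (hv (hi'.symm.trans hj')) hij
    · exact hturn j i hj hi hj' hi'
    · exact hturn i j hi hj hi' hj'
    · exact absurd (add_right_cancel (hv (hi'.symm.trans hj'))) hij
  · simp only [Function.Injective, not_forall] at hx'
    obtain ⟨i, j, hxij, hij⟩ := hx'
    rcases hN.endpoints_eq (hx i) (hxij ▸ hx j) with ⟨h, -⟩ | ⟨h, -⟩
    · exact absurd (hv h) hij
    · exact ⟨j, by rw [← hxij, hv h]⟩

theorem isCorrect_of_cuspAcyclic (hN : N.IsTyped) (hloop : ∀ x v, ¬ N.Joins x v v)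
    (hac : CuspAcyclic hN.toGraph N.portColor) : N.IsCorrect := by
  intro k v x hcycle
  obtain ⟨i, hi⟩ := cuspAcyclic_iff.1 hac k v x hcycle.nodes_injective hcycle.joins
  have hne : i ≠ i + 1 := fun h => hloop (x i) (v i) (by simpa only [← h] using hcycle.joins i)
  rcases portColor_eq_iff.1 hi with hx | ⟨hlabel, hi, hi'⟩
  · exact absurd (hcycle.edges_injective hx) hne
  · exact ⟨v (i + 1), (hcycle.joins i).2.1, hlabel, i, i + 1, hne, hi, hi'⟩

theorem IsCorrect.not_joins_self (hc : N.IsCorrect) (x : ε) (v : ν) : ¬ N.Joins x v v := by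
  intro h
  have : Subsingleton (Fin (0 + 1)) := inferInstanceAs (Subsingleton (Fin 1))
  obtain ⟨w, -, -, i, j, hij, -⟩ := hc 0 (fun _ => v) (fun _ => x)
    ⟨Function.injective_of_subsingleton _, Function.injective_of_subsingleton _, fun _ => h⟩
  exact hij (Subsingleton.elim i j)

theorem IsCorrect.restrict (hc : N.IsCorrect) (hN : N.IsTyped) {W : Finset ν} (hW : W ⊆ N.nodes)
    (F : Finset ε) : (N.restrict W F).IsCorrect := by
  intro k v x hcycle
  have hjoins : ∀ i, N.Joins (x i) (v i) (v (i + 1)) := fun i =>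
    ⟨hW (hcycle.joins i).1, hW (hcycle.joins i).2.1, (hcycle.joins i).2.2⟩
  obtain ⟨w, hw, hlabel, i, j, hij, hi, hj⟩ :=
    hc k v x ⟨hcycle.nodes_injective, hcycle.edges_injective, hjoins⟩
  refine ⟨w, ?_, hlabel, i, j, hij, hi, hj⟩
  rcases hN.eq_or_eq_of_mem_prems (hjoins i) hw hi with rfl | rfl
  · exact (hcycle.joins i).1
  · exact (hcycle.joins i).2.1

theorem IsTyped.restrict (hN : N.IsTyped) {W : Finset ν} (hW : W ⊆ N.nodes) {F : Finset ε}
    (hprems : ∀ v ∈ W, ∀ x ∈ N.prems v, x ∈ F) (hconcls : ∀ v ∈ W, ∀ x ∈ N.concls v, x ∈ F) :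
    (N.restrict W F).IsTyped where
  prems_mem := hprems
  concls_mem := hconcls
  typing v hv := hN.typing v (hW hv)
  prems_nodup v hv := hN.prems_nodup v (hW hv)
  concls_nodup v hv := hN.concls_nodup v (hW hv)
  prems_unique v hv w hw := hN.prems_unique v (hW hv) w (hW hw)
  concls_unique v hv w hw := hN.concls_unique v (hW hv) w (hW hw)

theorem IsTyped.concls_eq_nil (hN : N.IsTyped) {c : ν} (hc : c ∈ N.nodes)
    (hlabel : N.label c = .cut) : N.concls c = [] := by
  obtain ⟨A, -, h⟩ := (hlabel ▸ hN.typing c hc).cut_inv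
  exact List.map_eq_nil_iff.1 h

theorem IsTyped.type_eq_dual (hN : N.IsTyped) {c : ν} (hc : c ∈ N.nodes) (hlabel : N.label c = .cut)
    {a a' : ε} (hprems : (N.prems c).Perm [a, a']) : N.type a' = (N.type a).dual := by
  obtain ⟨A, h, -⟩ := (hlabel ▸ hN.typing c hc).cut_inv
  have hperm := hprems.map N.type
  simp only [h, List.map_cons, List.map_nil, List.perm_pair, List.cons.injEq, and_true] at hperm
  obtain ⟨ha, ha'⟩ | ⟨ha', ha⟩ := hperm
  · rw [← ha, ← ha']
  · rw [← ha, ← ha', MLLFormula.dual_dual]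

open Classical in
/-- The cut-nodes of a typed graph. A `⊗/⅋`-expansion decreases their number by one, which makes the
expansions of a net terminate. -/
noncomputable def cuts (N : NetGraph α ν ε) : Finset ν :=
  N.nodes.filter fun v => N.label v = .cut

namespace TensorParStep

variable {c t p : ν} {e f a b a' b' : ε} {c₁ c₂ : ν}

theorem ne_of_mem (h : M.TensorParStep N c t p e f a b a' b' c₁ c₂) {v : ν} (hv : v ∈ N.nodes) :
    v ≠ c ∧ v ≠ t ∧ v ≠ p := by
  have hc := h.c_mem
  have ht := h.t_mem
  have hp := h.p_mem
  have hc₁ := h.c₁_fresh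
  have hc₂ := h.c₂_fresh
  rcases (h.mem_nodes v).1 hv with hv | rfl | rfl
  · exact hv.2
  · exact ⟨by grind, by grind, by grind⟩
  · exact ⟨by grind, by grind, by grind⟩

theorem nodes_distinct (h : M.TensorParStep N c t p e f a b a' b' c₁ c₂) :
    c ≠ t ∧ c ≠ p ∧ t ≠ p := by
  have hc := h.c_label
  have ht := h.t_label
  have hp := h.p_label
  grind

theorem c₁_mem (h : M.TensorParStep N c t p e f a b a' b' c₁ c₂) : c₁ ∈ N.nodes :=
  (h.mem_nodes c₁).2 (.inr (.inl rfl))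

theorem c₂_mem (h : M.TensorParStep N c t p e f a b a' b' c₁ c₂) : c₂ ∈ N.nodes :=
  (h.mem_nodes c₂).2 (.inr (.inr rfl))

theorem mem_nodes_iff (h : M.TensorParStep N c t p e f a b a' b' c₁ c₂) {v : ν} :
    v ∈ M.nodes ↔ v = c ∨ v = t ∨ v = p ∨ (v ∈ N.nodes ∧ v ≠ c₁ ∧ v ≠ c₂) := by
  have hv := h.mem_nodes v
  have hc := h.c_mem
  have ht := h.t_mem
  have hp := h.p_mem
  have hc₁ := h.c₁_fresh
  have hc₂ := h.c₂_fresh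
  grind

theorem eq_of_mem (h : M.TensorParStep N c t p e f a b a' b' c₁ c₂) {v : ν} (hv : v ∈ N.nodes)
    (hv₁ : v ≠ c₁) (hv₂ : v ≠ c₂) :
    M.label v = N.label v ∧ M.prems v = N.prems v ∧ M.concls v = N.concls v := by
  obtain ⟨hc, ht, hp⟩ := h.ne_of_mem hv
  obtain ⟨hlabel, hprems, hconcls⟩ :=
    h.nodes_unchanged v (h.mem_nodes_iff.2 (.inr (.inr (.inr ⟨hv, hv₁, hv₂⟩)))) hc ht hp
  exact ⟨hlabel.symm, hprems.symm, hconcls.symm⟩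

theorem card_cuts (h : M.TensorParStep N c t p e f a b a' b' c₁ c₂) :
    N.cuts.card = M.cuts.card + 1 := by
  classical
  have hc : c ∈ M.cuts := Finset.mem_filter.2 ⟨h.c_mem, h.c_label⟩
  have hc₁ : c₁ ∉ M.cuts := fun h₁ => h.c₁_fresh (Finset.mem_filter.1 h₁).1
  have hc₂ : c₂ ∉ M.cuts := fun h₂ => h.c₂_fresh (Finset.mem_filter.1 h₂).1
  have hcuts : N.cuts = insert c₁ (insert c₂ (M.cuts.erase c)) := by
    ext v
    have hnodes := h.mem_nodes v
    have hold := h.nodes_unchanged v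
    have ht := h.t_label
    have hp := h.p_label
    have hl₁ := h.c₁_label
    have hl₂ := h.c₂_label
    simp only [cuts, Finset.mem_filter, Finset.mem_insert, Finset.mem_erase]
    grind
  have hne := h.c₁_ne_c₂
  rw [hcuts, Finset.card_insert_of_notMem (by grind), Finset.card_insert_of_notMem (by grind),
    Finset.card_erase_add_one hc]

theorem prems_distinct (h : M.TensorParStep N c t p e f a b a' b' c₁ c₂) (hN : N.IsTyped) :
    a ≠ a' ∧ b ≠ b' ∧ a ≠ b ∧ a ≠ b' ∧ a' ≠ b ∧ a' ≠ b' := by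
  have hnodup₁ := h.c₁_prems.nodup_iff.1 (hN.prems_nodup _ h.c₁_mem)
  have hnodup₂ := h.c₂_prems.nodup_iff.1 (hN.prems_nodup _ h.c₂_mem)
  have hdisj := hN.prems_unique _ h.c₁_mem _ h.c₂_mem
  simp only [h.c₁_prems.mem_iff, h.c₂_prems.mem_iff] at hdisj
  have hne := h.c₁_ne_c₂
  grind

theorem prems_mem_edges (h : M.TensorParStep N c t p e f a b a' b' c₁ c₂) (hN : N.IsTyped) :
    a ∈ N.edges ∧ a' ∈ N.edges ∧ b ∈ N.edges ∧ b' ∈ N.edges := by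
  have h₁ := hN.prems_mem _ h.c₁_mem
  have h₂ := hN.prems_mem _ h.c₂_mem
  simp only [h.c₁_prems.mem_iff, h.c₂_prems.mem_iff] at h₁ h₂
  exact ⟨h₁ a (by simp), h₁ a' (by simp), h₂ b (by simp), h₂ b' (by simp)⟩

theorem prem_cases (h : M.TensorParStep N c t p e f a b a' b' c₁ c₂) {v : ν} {x : ε}
    (hv : v ∈ M.nodes) (hx : x ∈ M.prems v) :
    (v = c ∧ (x = e ∨ x = f)) ∨ (v = t ∧ (x = a ∨ x = b)) ∨ (v = p ∧ (x = a' ∨ x = b')) ∨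
      ((v ∈ N.nodes ∧ v ≠ c₁ ∧ v ≠ c₂) ∧ x ∈ N.prems v) := by
  rcases h.mem_nodes_iff.1 hv with rfl | rfl | rfl | hv
  · exact .inl ⟨rfl, by simpa using h.c_prems.mem_iff.1 hx⟩
  · exact .inr (.inl ⟨rfl, by simpa [h.t_prems] using hx⟩)
  · exact .inr (.inr (.inl ⟨rfl, by simpa [h.p_prems] using hx⟩))
  · exact .inr (.inr (.inr ⟨hv, by rwa [(h.eq_of_mem hv.1 hv.2.1 hv.2.2).2.1] at hx⟩))

theorem concl_cases (h : M.TensorParStep N c t p e f a b a' b' c₁ c₂) (hc : M.concls c = [])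
    {v : ν} {x : ε} (hv : v ∈ M.nodes) (hx : x ∈ M.concls v) :
    (v = t ∧ x = e) ∨ (v = p ∧ x = f) ∨ ((v ∈ N.nodes ∧ v ≠ c₁ ∧ v ≠ c₂) ∧ x ∈ N.concls v) := by
  rcases h.mem_nodes_iff.1 hv with rfl | rfl | rfl | hv
  · simp [hc] at hx
  · exact .inl ⟨rfl, by simpa [h.t_concls] using hx⟩
  · exact .inr (.inl ⟨rfl, by simpa [h.p_concls] using hx⟩)
  · exact .inr (.inr ⟨hv, by rwa [(h.eq_of_mem hv.1 hv.2.1 hv.2.2).2.2] at hx⟩)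

theorem prems_unique (h : M.TensorParStep N c t p e f a b a' b' c₁ c₂) (hN : N.IsTyped) {v w : ν}
    {x : ε} (hv : v ∈ M.nodes) (hw : w ∈ M.nodes) (hxv : x ∈ M.prems v) (hxw : x ∈ M.prems w) :
    v = w := by
  have hne := h.prems_distinct hN
  have hmem := h.prems_mem_edges hN
  have he := h.mem_edges e
  have hf := h.mem_edges f
  have hprems₁ := fun u hu => hN.prems_unique u hu _ h.c₁_mem x
  have hprems₂ := fun u hu => hN.prems_unique u hu _ h.c₂_mem x
  have hedges := fun u hu => hN.prems_mem u hu x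
  simp only [h.c₁_prems.mem_iff, h.c₂_prems.mem_iff, List.mem_cons, List.not_mem_nil,
    or_false] at hprems₁ hprems₂
  rcases h.prem_cases hv hxv with hv | hv | hv | ⟨⟨hv, hv'⟩, hxv⟩ <;>
    rcases h.prem_cases hw hxw with hw | hw | hw | ⟨⟨hw, hw'⟩, hxw⟩
  case inr.inr.inr.inr.inr.inr => exact hN.prems_unique v hv w hw x hxv hxw
  all_goals clear h; grind

theorem concls_unique (h : M.TensorParStep N c t p e f a b a' b' c₁ c₂) (hN : N.IsTyped)
    (hef : e ≠ f) (hc : M.concls c = []) {v w : ν} {x : ε} (hv : v ∈ M.nodes) (hw : w ∈ M.nodes)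
    (hxv : x ∈ M.concls v) (hxw : x ∈ M.concls w) : v = w := by
  have he := h.mem_edges e
  have hf := h.mem_edges f
  have hedges := fun u hu => hN.concls_mem u hu x
  rcases h.concl_cases hc hv hxv with hv | hv | ⟨⟨hv, -⟩, hxv⟩ <;>
    rcases h.concl_cases hc hw hxw with hw | hw | ⟨⟨hw, -⟩, hxw⟩
  case inr.inr.inr.inr => exact hN.concls_unique v hv w hw x hxv hxw
  all_goals clear h; grind

theorem typing (h : M.TensorParStep N c t p e f a b a' b' c₁ c₂) (hN : N.IsTyped)
    (hc : M.concls c = []) (hte : M.type e = .tensor (N.type a) (N.type b))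
    (htf : M.type f = .par (N.type a') (N.type b')) {v : ν} (hv : v ∈ M.nodes) :
    (M.label v).Typing ((M.prems v).map M.type) ((M.concls v).map M.type) := by
  obtain ⟨ha, ha', hb, hb'⟩ := h.prems_mem_edges hN
  have htype := h.edges_unchanged
  rcases h.mem_nodes_iff.1 hv with rfl | rfl | rfl | ⟨hv, hv₁, hv₂⟩
  · have hdual : M.type f = (M.type e).dual := by
      rw [hte, htf, MLLFormula.dual, hN.type_eq_dual h.c₁_mem h.c₁_label h.c₁_prems,
        hN.type_eq_dual h.c₂_mem h.c₂_label h.c₂_prems]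
    rw [h.c_label, hc]
    rcases List.perm_pair.1 h.c_prems with hprems | hprems <;> rw [hprems]
    · simpa only [List.map_cons, List.map_nil, hdual] using .cut (M.type e)
    · have hcut := NodeLabel.Typing.cut (M.type e).dual
      rw [MLLFormula.dual_dual] at hcut
      simpa only [List.map_cons, List.map_nil, hdual] using hcut
  · rw [h.t_label, h.t_prems, h.t_concls, List.map_singleton, hte, htype a ha, htype b hb]
    exact .tensor _ _
  · rw [h.p_label, h.p_prems, h.p_concls, List.map_singleton, htf, htype a' ha', htype b' hb']
    exact .par _ _
  · obtain ⟨hlabel, hprems, hconcls⟩ := h.eq_of_mem hv hv₁ hv₂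
    rw [hlabel, hprems, hconcls,
      List.map_congr_left fun x hx => (htype x (hN.prems_mem v hv x hx)).symm,
      List.map_congr_left fun x hx => (htype x (hN.concls_mem v hv x hx)).symm]
    exact hN.typing v hv

theorem isTyped (h : M.TensorParStep N c t p e f a b a' b' c₁ c₂) (hN : N.IsTyped)
    (he : e ∈ M.edges) (hf : f ∈ M.edges) (hef : e ≠ f) (hc : M.concls c = [])
    (hte : M.type e = .tensor (N.type a) (N.type b))
    (htf : M.type f = .par (N.type a') (N.type b')) : M.IsTyped where
  prems_mem v hv x hx := by
    have hmem := h.prems_mem_edges hN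
    have hold := fun x hx => ((h.mem_edges x).1 hx).1
    rcases h.prem_cases hv hx with ⟨-, hx⟩ | ⟨-, hx⟩ | ⟨-, hx⟩ | ⟨⟨hv, -⟩, hx⟩
    · grind
    · grind
    · grind
    · exact hold x (hN.prems_mem v hv x hx)
  concls_mem v hv x hx := by
    rcases h.concl_cases hc hv hx with ⟨-, rfl⟩ | ⟨-, rfl⟩ | ⟨⟨hv, -⟩, hx⟩
    · exact he
    · exact hf
    · exact ((h.mem_edges x).1 (hN.concls_mem v hv x hx)).1
  typing _ := h.typing hN hc hte htf
  prems_nodup v hv := by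
    have hne := h.prems_distinct hN
    rcases h.mem_nodes_iff.1 hv with rfl | rfl | rfl | ⟨hv, hv₁, hv₂⟩
    · simp [h.c_prems.nodup_iff, hef]
    · simp [h.t_prems, hne]
    · simp [h.p_prems, hne]
    · rw [(h.eq_of_mem hv hv₁ hv₂).2.1]
      exact hN.prems_nodup v hv
  concls_nodup v hv := by
    rcases h.mem_nodes_iff.1 hv with rfl | rfl | rfl | ⟨hv, hv₁, hv₂⟩
    · simp [hc]
    · simp [h.t_concls]
    · simp [h.p_concls]
    · rw [(h.eq_of_mem hv hv₁ hv₂).2.2]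
      exact hN.concls_nodup v hv
  prems_unique _ hv _ hw _ := h.prems_unique hN hv hw
  concls_unique _ hv _ hw _ := h.concls_unique hN hef hc hv hw

theorem exists_mem_concls (h : M.TensorParStep N c t p e f a b a' b' c₁ c₂) (hN : N.IsProofNet)
    {x : ε} (hx : x ∈ M.edges) : ∃ v ∈ M.nodes, x ∈ M.concls v := by
  by_cases hxe : x = e
  · exact ⟨t, h.t_mem, by simp [h.t_concls, hxe]⟩
  by_cases hxf : x = f
  · exact ⟨p, h.p_mem, by simp [h.p_concls, hxf]⟩
  obtain ⟨v, hv, hxv⟩ := hN.edge_is_concl x ((h.mem_edges x).2 ⟨hx, hxe, hxf⟩)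
  have hv₁ : v ≠ c₁ := by
    rintro rfl
    simp [h.c₁_concls] at hxv
  have hv₂ : v ≠ c₂ := by
    rintro rfl
    simp [h.c₂_concls] at hxv
  exact ⟨v, h.mem_nodes_iff.2 (.inr (.inr (.inr ⟨hv, hv₁, hv₂⟩))),
    (h.eq_of_mem hv hv₁ hv₂).2.2 ▸ hxv⟩

theorem not_mem_concls_c (h : M.TensorParStep N c t p e f a b a' b' c₁ c₂) (hM : M.IsTyped)
    (x : ε) : x ∉ M.concls c := by
  simp [hM.concls_eq_nil h.c_mem h.c_label]

theorem mem_c_prems (h : M.TensorParStep N c t p e f a b a' b' c₁ c₂) {x : ε} :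
    x ∈ M.prems c ↔ x = e ∨ x = f := by
  simp [h.c_prems.mem_iff]

theorem eq_c_of_mem_prems (h : M.TensorParStep N c t p e f a b a' b' c₁ c₂) (hM : M.IsTyped)
    {x : ε} {w : ν} (hx : x = e ∨ x = f) (hw : w ∈ M.nodes) (hxw : x ∈ M.prems w) : w = c :=
  hM.prems_unique _ hw _ h.c_mem x hxw (h.mem_c_prems.2 hx)

theorem mem_concls_of_mem_edges (h : M.TensorParStep N c t p e f a b a' b' c₁ c₂)
    (hM : M.IsTyped) {x : ε} (hx : x ∈ N.edges) {w : ν} (hw : w ∈ M.nodes)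
    (hxw : x ∈ M.concls w) : w ∈ N.nodes ∧ x ∈ N.concls w := by
  have hef := (h.mem_edges x).1 hx
  have := h.concl_cases (hM.concls_eq_nil h.c_mem h.c_label) hw hxw
  tauto

theorem link_c (h : M.TensorParStep N c t p e f a b a' b' c₁ c₂) (hM : M.IsTyped) {x : ε} {w : ν}
    (hx : M.Joins x c w) : (x = e ∧ w = t) ∨ (x = f ∧ w = p) := by
  obtain ⟨-, hw, ⟨hx, -⟩ | ⟨hxw, hx⟩⟩ := hx
  · exact absurd hx (h.not_mem_concls_c hM x)
  · rcases h.mem_c_prems.1 hx with rfl | rfl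
    · exact .inl ⟨rfl, hM.concls_unique _ hw _ h.t_mem x hxw (by simp [h.t_concls])⟩
    · exact .inr ⟨rfl, hM.concls_unique _ hw _ h.p_mem x hxw (by simp [h.p_concls])⟩

theorem link_t (h : M.TensorParStep N c t p e f a b a' b' c₁ c₂) (hM : M.IsTyped)
    (hN : N.IsTyped) {x : ε} {w : ν} (hx : M.Joins x t w) :
    (x = a ∧ N.Joins a c₁ w) ∨ (x = b ∧ N.Joins b c₂ w) ∨ (x = e ∧ w = c) := by
  have hmem := h.prems_mem_edges hN
  obtain ⟨-, hw, ⟨hx, hxw⟩ | ⟨hxw, hx⟩⟩ := hx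
  · rw [h.t_concls, List.mem_singleton] at hx
    exact .inr (.inr ⟨hx, h.eq_c_of_mem_prems hM (.inl hx) hw hxw⟩)
  · simp only [h.t_prems, List.mem_cons, List.not_mem_nil, or_false] at hx
    rcases hx with rfl | rfl
    · obtain ⟨hw, hxw⟩ := h.mem_concls_of_mem_edges hM hmem.1 hw hxw
      exact .inl ⟨rfl, h.c₁_mem, hw, .inr ⟨hxw, by simp [h.c₁_prems.mem_iff]⟩⟩
    · obtain ⟨hw, hxw⟩ := h.mem_concls_of_mem_edges hM hmem.2.2.1 hw hxw
      exact .inr (.inl ⟨rfl, h.c₂_mem, hw, .inr ⟨hxw, by simp [h.c₂_prems.mem_iff]⟩⟩)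

theorem link_p (h : M.TensorParStep N c t p e f a b a' b' c₁ c₂) (hM : M.IsTyped)
    (hN : N.IsTyped) {x : ε} {w : ν} (hx : M.Joins x p w) :
    (x = a' ∧ N.Joins a' c₁ w) ∨ (x = b' ∧ N.Joins b' c₂ w) ∨ (x = f ∧ w = c) := by
  have hmem := h.prems_mem_edges hN
  obtain ⟨-, hw, ⟨hx, hxw⟩ | ⟨hxw, hx⟩⟩ := hx
  · rw [h.p_concls, List.mem_singleton] at hx
    exact .inr (.inr ⟨hx, h.eq_c_of_mem_prems hM (.inr hx) hw hxw⟩)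
  · simp only [h.p_prems, List.mem_cons, List.not_mem_nil, or_false] at hx
    rcases hx with rfl | rfl
    · obtain ⟨hw, hxw⟩ := h.mem_concls_of_mem_edges hM hmem.2.1 hw hxw
      exact .inl ⟨rfl, h.c₁_mem, hw, .inr ⟨hxw, by simp [h.c₁_prems.mem_iff]⟩⟩
    · obtain ⟨hw, hxw⟩ := h.mem_concls_of_mem_edges hM hmem.2.2.2 hw hxw
      exact .inr (.inl ⟨rfl, h.c₂_mem, hw, .inr ⟨hxw, by simp [h.c₂_prems.mem_iff]⟩⟩)

theorem link_old (h : M.TensorParStep N c t p e f a b a' b' c₁ c₂) {x : ε} {u w : ν}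
    (hx : M.Joins x u w) (hu : u ≠ c ∧ u ≠ t ∧ u ≠ p) (hw : w ≠ c ∧ w ≠ t ∧ w ≠ p) :
    N.Joins x u w := by
  obtain ⟨huM, hwM, hx⟩ := hx
  have hu' := h.nodes_unchanged u huM hu.1 hu.2.1 hu.2.2
  have hw' := h.nodes_unchanged w hwM hw.1 hw.2.1 hw.2.2
  exact ⟨(h.mem_nodes u).2 (.inl ⟨huM, hu⟩), (h.mem_nodes w).2 (.inl ⟨hwM, hw⟩),
    by rwa [hu'.2.1, hu'.2.2, hw'.2.1, hw'.2.2]⟩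

theorem not_joins_self (h : M.TensorParStep N c t p e f a b a' b' c₁ c₂) (hM : M.IsTyped)
    (hN : N.IsProofNet) (x : ε) (v : ν) : ¬ M.Joins x v v := by
  intro hx
  have hne := h.nodes_distinct
  have hold := fun hv => hN.correct.not_joins_self x v (h.link_old hx hv hv)
  have hfresh := fun v (hv : v ∈ N.nodes) => h.ne_of_mem hv
  have hc : v ≠ c := by
    rintro rfl
    have := h.link_c hM hx
    tauto
  have ht : v ≠ t := by
    rintro rfl
    rcases h.link_t hM hN.typed hx with ⟨-, hv⟩ | ⟨-, hv⟩ | ⟨-, hv⟩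
    · exact (hfresh v hv.2.1).2.1 rfl
    · exact (hfresh v hv.2.1).2.1 rfl
    · exact hc hv
  have hp : v ≠ p := by
    rintro rfl
    rcases h.link_p hM hN.typed hx with ⟨-, hv⟩ | ⟨-, hv⟩ | ⟨-, hv⟩
    · exact (hfresh v hv.2.1).2.2 rfl
    · exact (hfresh v hv.2.1).2.2 rfl
    · exact hc hv
  exact hold ⟨hc, ht, hp⟩

open Classical in
theorem isExpansion (h : M.TensorParStep N c t p e f a b a' b' c₁ c₂) (hM : M.IsTyped)
    (hN : N.IsTyped) :
    IsExpansion ⟨c, t, p, e, f, a, b, a', b', c₁, c₂⟩ hN.toGraph hM.toGraph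
      ((N.nodes : Set ν).piecewise N.portColor M.portColor) where
  fresh _ := h.ne_of_mem
  removed _ hv := ⟨ne_of_mem_of_not_mem hv h.c₁_fresh, ne_of_mem_of_not_mem hv h.c₂_fresh⟩
  link_c _ _ := h.link_c hM
  link_t _ _ := h.link_t hM hN
  link_p _ _ := h.link_p hM hN
  link_old _ _ _ hx hu₁ hu₂ hu₃ hw₁ hw₂ hw₃ := h.link_old hx ⟨hu₁, hu₂, hu₃⟩ ⟨hw₁, hw₂, hw₃⟩
  color_p := by
    have hp : p ∉ N.nodes := fun hp => (h.ne_of_mem hp).2.2 rfl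
    simp [Set.piecewise, hp, portColor_eq_iff, h.p_label, h.p_prems]
  color_c₁ := by
    simp [Set.piecewise, h.c₁_mem, portColor_eq_iff, h.c₁_label, (h.prems_distinct hN).1]
  color_c₂ := by
    simp [Set.piecewise, h.c₂_mem, portColor_eq_iff, h.c₂_label, (h.prems_distinct hN).2.1]
  c_ne_t := h.nodes_distinct.1
  c₁_ne_c₂ := h.c₁_ne_c₂

theorem portColor_eq (h : M.TensorParStep N c t p e f a b a' b' c₁ c₂) {v : ν} (hv : v ∈ M.nodes)
    (hv' : v ∈ N.nodes) : N.portColor v = M.portColor v := by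
  obtain ⟨hlabel, hprems, -⟩ := h.eq_of_mem hv' (fun h₁ => h.c₁_fresh (h₁ ▸ hv))
    (fun h₂ => h.c₂_fresh (h₂ ▸ hv))
  classical
  ext1 x
  exact if_congr (by rw [hlabel, hprems]) rfl rfl

theorem isProofNet (h : M.TensorParStep N c t p e f a b a' b' c₁ c₂) (hM : M.IsTyped)
    (hN : N.IsProofNet)
    (hgood : ∀ l, IsPath hN.typed.toGraph c₁ l c₂ → CuspFree N.portColor l →
      ∀ d ∈ l, d.edge ≠ a ∧ d.edge ≠ b) : M.IsProofNet := by
  classical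
  have hcolN : ∀ v ∈ N.nodes, ∀ x,
      N.portColor v x = (N.nodes : Set ν).piecewise N.portColor M.portColor v x := fun v hv x => by
    rw [Set.piecewise_eq_of_mem _ _ _ hv]
  have hcolM : ∀ v ∈ M.nodes, ∀ x,
      (N.nodes : Set ν).piecewise N.portColor M.portColor v x = M.portColor v x := fun v hv x => by
    by_cases hv' : v ∈ N.nodes
    · rw [Set.piecewise_eq_of_mem _ _ _ hv', h.portColor_eq hv hv']
    · rw [Set.piecewise_eq_of_notMem _ _ _ hv']
  have hac := (hN.correct.cuspAcyclic hN.typed).congr hcolN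
  have hac' := (h.isExpansion hM hN.typed).cuspAcyclic hac fun l hl hc =>
    hgood l hl (hc.congr hl.isWalk fun v hv x => (hcolN v hv x).symm)
  exact ⟨hM, fun _ => h.exists_mem_concls hN,
    isCorrect_of_cuspAcyclic hM (h.not_joins_self hM hN) (hac'.congr hcolM)⟩

end TensorParStep

open Classical in
/-- The graph obtained by merging the two cuts `X.c₁` and `X.c₂` of `N` into the cut `X.c`, between
a new `⊗`-node and a new `⅋`-node: the `⊗/⅋`-expansion of `N` with redex `X`. -/
noncomputable def expand (N : NetGraph α ν ε) (X : Redex ν ε) : NetGraph α ν ε where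
  nodes := insert X.c (insert X.t (insert X.p ((N.nodes.erase X.c₁).erase X.c₂)))
  edges := insert X.e (insert X.f N.edges)
  label v := if v = X.c then .cut else if v = X.t then .tensor else if v = X.p then .par
    else N.label v
  prems v := if v = X.c then [X.e, X.f] else if v = X.t then [X.a, X.b]
    else if v = X.p then [X.a', X.b'] else N.prems v
  concls v := if v = X.c then [] else if v = X.t then [X.e] else if v = X.p then [X.f]
    else N.concls v
  type x := if x = X.e then .tensor (N.type X.a) (N.type X.b)
    else if x = X.f then .par (N.type X.a') (N.type X.b') else N.type x

theorem IsTyped.tensorParStep_expand (hN : N.IsTyped) {X : Redex ν ε} (hc : X.c ∉ N.nodes)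
    (ht : X.t ∉ N.nodes) (hp : X.p ∉ N.nodes) (hct : X.c ≠ X.t) (hcp : X.c ≠ X.p)
    (htp : X.t ≠ X.p) (he : X.e ∉ N.edges) (hf : X.f ∉ N.edges) (hc₁ : X.c₁ ∈ N.nodes)
    (hc₂ : X.c₂ ∈ N.nodes) (hc₁₂ : X.c₁ ≠ X.c₂) (hlabel₁ : N.label X.c₁ = .cut)
    (hlabel₂ : N.label X.c₂ = .cut) (hprems₁ : (N.prems X.c₁).Perm [X.a, X.a'])
    (hprems₂ : (N.prems X.c₂).Perm [X.b, X.b']) :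
    (N.expand X).TensorParStep N X.c X.t X.p X.e X.f X.a X.b X.a' X.b' X.c₁ X.c₂ where
  c_mem := by simp [expand]
  t_mem := by simp [expand]
  p_mem := by simp [expand]
  c_label := by simp [expand]
  t_label := by simp [expand, hct.symm]
  p_label := by simp [expand, hcp.symm, htp.symm]
  c_prems := by simp [expand]
  t_prems := by simp [expand, hct.symm]
  t_concls := by simp [expand, hct.symm]
  p_prems := by simp [expand, hcp.symm, htp.symm]
  p_concls := by simp [expand, hcp.symm, htp.symm]
  c₁_fresh := by
    simp only [expand, Finset.mem_insert, Finset.mem_erase]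
    grind
  c₂_fresh := by
    simp only [expand, Finset.mem_insert, Finset.mem_erase]
    grind
  c₁_ne_c₂ := hc₁₂
  mem_nodes v := by
    simp only [expand, Finset.mem_insert, Finset.mem_erase]
    grind
  mem_edges x := by
    simp only [expand, Finset.mem_insert]
    grind
  c₁_label := hlabel₁
  c₂_label := hlabel₂
  c₁_prems := hprems₁
  c₂_prems := hprems₂
  c₁_concls := hN.concls_eq_nil hc₁ hlabel₁
  c₂_concls := hN.concls_eq_nil hc₂ hlabel₂
  nodes_unchanged v _ hvc hvt hvp := by simp [expand, hvc, hvt, hvp]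
  edges_unchanged x hx := by
    simp [expand, ne_of_mem_of_not_mem hx he, ne_of_mem_of_not_mem hx hf]

theorem IsTyped.exists_tensorParStep [Infinite ν] [Infinite ε] (hN : N.IsTyped) {c₁ c₂ : ν}
    {a a' b b' : ε} (hc₁ : c₁ ∈ N.nodes) (hc₂ : c₂ ∈ N.nodes) (hc₁₂ : c₁ ≠ c₂)
    (hlabel₁ : N.label c₁ = .cut) (hlabel₂ : N.label c₂ = .cut)
    (hprems₁ : (N.prems c₁).Perm [a, a']) (hprems₂ : (N.prems c₂).Perm [b, b']) :
    ∃ (M : NetGraph α ν ε) (c t p : ν) (e f : ε),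
      M.IsTyped ∧ M.TensorParStep N c t p e f a b a' b' c₁ c₂ := by
  classical
  obtain ⟨c, hc⟩ := Infinite.exists_notMem_finset N.nodes
  obtain ⟨t, ht⟩ := Infinite.exists_notMem_finset (insert c N.nodes)
  obtain ⟨p, hp⟩ := Infinite.exists_notMem_finset (insert c (insert t N.nodes))
  obtain ⟨e, he⟩ := Infinite.exists_notMem_finset N.edges
  obtain ⟨f, hf⟩ := Infinite.exists_notMem_finset (insert e N.edges)
  simp only [Finset.mem_insert, not_or] at ht hp hf
  let X : Redex ν ε := ⟨c, t, p, e, f, a, b, a', b', c₁, c₂⟩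
  have hstep := hN.tensorParStep_expand (X := X) hc ht.2 hp.2.2 (Ne.symm ht.1) (Ne.symm hp.1)
    (Ne.symm hp.2.1) he hf.2 hc₁ hc₂ hc₁₂ hlabel₁ hlabel₂ hprems₁ hprems₂
  exact ⟨N.expand X, c, t, p, e, f, hstep.isTyped hN (by simp [expand, X]) (by simp [expand, X])
    (Ne.symm hf.1) (by simp [expand, X]) (by simp [expand, X]) (by simp [expand, X, hf.1]), hstep⟩

theorem IsProofNet.restrict (hN : N.IsProofNet) {W : Finset ν} {F : Finset ε} (hW : W ⊆ N.nodes)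
    (hprems : ∀ v ∈ W, ∀ x ∈ N.prems v, x ∈ F) (hconcls : ∀ v ∈ W, ∀ x ∈ N.concls v, x ∈ F)
    (hF : ∀ x ∈ F, ∃ v ∈ W, x ∈ N.concls v) : (N.restrict W F).IsProofNet where
  typed := hN.typed.restrict hW hprems hconcls
  edge_is_concl := hF
  correct := hN.correct.restrict hN.typed hW F

end NetGraph

namespace PartitionedNet

open EdgeDart

open scoped Graph

variable {α ν ε : Type*} {n : ℕ} {R R' : PartitionedNet α ν ε n} {i j k l : Fin n} {v : ν} {x : ε}

theorem isConclusion_part_of_mem_prems (hR : R.net.IsTyped) (hsub : R.partNodes k ⊆ R.net.nodes)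
    (hv : v ∈ R.net.nodes) (hvk : v ∉ R.partNodes k) (hxv : x ∈ R.net.prems v)
    (hx : x ∈ R.partEdges k) : (R.part k).IsConclusion x :=
  ⟨hx, fun _ hw hxw => hvk (hR.prems_unique _ hv _ (hsub hw) x hxv hxw ▸ hw)⟩

theorem isCutBetween_iff (hR : R.net.IsTyped) (hsub : ∀ m, R.partNodes m ⊆ R.net.nodes) :
    R.IsCutBetween v k l ↔ v ∈ R.net.nodes ∧ (∀ m, v ∉ R.partNodes m) ∧ R.net.label v = .cut ∧
      ∃ x y, (R.net.prems v).Perm [x, y] ∧ x ∈ R.partEdges k ∧ y ∈ R.partEdges l := by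
  refine and_congr_right fun hv => and_congr_right fun hvm => and_congr_right fun _ =>
    exists_congr fun x => exists_congr fun y => and_congr_right fun hprems => and_congr ?_ ?_
  · exact ⟨And.left,
      isConclusion_part_of_mem_prems hR (hsub k) hv (hvm k) (hprems.mem_iff.2 (by simp))⟩
  · exact ⟨And.left,
      isConclusion_part_of_mem_prems hR (hsub l) hv (hvm l) (hprems.mem_iff.2 (by simp))⟩

namespace IsPartition

theorem eq_of_mem_partEdges (hR : R.IsPartition) (hk : x ∈ R.partEdges k)
    (hl : x ∈ R.partEdges l) : k = l := by
  by_contra hkl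
  exact Finset.disjoint_left.1 (hR.partEdges_disjoint k l hkl) hk hl

theorem eq_of_isCutBetween (hR : R.IsPartition) (h : R.IsCutBetween v i j)
    (h' : R.IsCutBetween v k l) : (k = i ∧ l = j) ∨ (k = j ∧ l = i) := by
  obtain ⟨-, -, -, a, b, hprems, ha, hb⟩ := h
  obtain ⟨-, -, -, a', b', hprems', ha', hb'⟩ := h'
  have hperm := List.perm_pair.1 (hprems.symm.trans hprems')
  simp only [List.cons.injEq, and_true] at hperm
  obtain ⟨rfl, rfl⟩ | ⟨rfl, rfl⟩ := hperm
  · exact .inl ⟨hR.eq_of_mem_partEdges ha'.1 ha.1, hR.eq_of_mem_partEdges hb'.1 hb.1⟩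
  · exact .inr ⟨hR.eq_of_mem_partEdges ha'.1 hb.1, hR.eq_of_mem_partEdges hb'.1 ha.1⟩

end IsPartition

/-- `ExpandsAt R R' i j` with an explicit redex. -/
structure ExpandsBy (R R' : PartitionedNet α ν ε n) (i j : Fin n) (X : Redex ν ε) : Prop where
  ne : i ≠ j
  step : R'.net.TensorParStep R.net X.c X.t X.p X.e X.f X.a X.b X.a' X.b' X.c₁ X.c₂
  isProofNet : R'.net.IsProofNet
  cut₁ : R.IsCutBetween X.c₁ i j
  cut₂ : R.IsCutBetween X.c₂ i j
  a_mem : X.a ∈ R.partEdges i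
  b_mem : X.b ∈ R.partEdges i
  a'_mem : X.a' ∈ R.partEdges j
  b'_mem : X.b' ∈ R.partEdges j
  mem_partNodes : ∀ k v, v ∈ R'.partNodes k ↔ v ∈ R.partNodes k ∨ (k = i ∧ v = X.t) ∨
    (k = j ∧ v = X.p)
  mem_partEdges : ∀ k x, x ∈ R'.partEdges k ↔ x ∈ R.partEdges k ∨ (k = i ∧ x = X.e) ∨
    (k = j ∧ x = X.f)

namespace ExpandsBy

variable {X : Redex ν ε}

theorem expandsAt (h : R.ExpandsBy R' i j X) (hR : R.net.IsProofNet) : R.ExpandsAt R' i j :=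
  ⟨hR, h.isProofNet, h.ne, X.c, X.t, X.p, X.e, X.f, X.a, X.b, X.a', X.b', X.c₁, X.c₂, h.step,
    h.cut₁, h.cut₂, h.a_mem, h.b_mem, h.a'_mem, h.b'_mem, h.mem_partNodes, h.mem_partEdges⟩

theorem mem_partNodes_iff_of_mem (h : R.ExpandsBy R' i j X) (hv : v ∈ R.net.nodes) :
    v ∈ R'.partNodes k ↔ v ∈ R.partNodes k := by
  simp [h.mem_partNodes, h.step.ne_of_mem hv]

theorem mem_partEdges_iff_of_mem (h : R.ExpandsBy R' i j X) (hx : x ∈ R.net.edges) :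
    x ∈ R'.partEdges k ↔ x ∈ R.partEdges k := by
  simp [h.mem_partEdges, ((h.step.mem_edges x).1 hx).2]

theorem c_notMem_partNodes (h : R.ExpandsBy R' i j X) (hR : R.IsPartition) :
    X.c ∉ R'.partNodes k := by
  have hne := h.step.nodes_distinct
  have hc : X.c ∉ R.partNodes k := fun hc =>
    (h.step.ne_of_mem (hR.partNodes_subset k hc)).1 rfl
  simp [h.mem_partNodes, hne, hc]

theorem e_ne_f (h : R.ExpandsBy R' i j X) : X.e ≠ X.f := by
  simpa [h.step.c_prems.nodup_iff] using h.isProofNet.typed.prems_nodup _ h.step.c_mem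

theorem e_mem_partEdges (h : R.ExpandsBy R' i j X) (hR : R.IsPartition) :
    X.e ∈ R'.partEdges k ↔ k = i := by
  have he : X.e ∉ R.partEdges k := fun he =>
    ((h.step.mem_edges _).1 (hR.partEdges_subset k he)).2.1 rfl
  simp [h.mem_partEdges, he, h.e_ne_f]

theorem f_mem_partEdges (h : R.ExpandsBy R' i j X) (hR : R.IsPartition) :
    X.f ∈ R'.partEdges k ↔ k = j := by
  have hf : X.f ∉ R.partEdges k := fun hf =>
    ((h.step.mem_edges _).1 (hR.partEdges_subset k hf)).2.2 rfl
  simp [h.mem_partEdges, hf, h.e_ne_f.symm]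

theorem partNodes_subset (h : R.ExpandsBy R' i j X) (hR : R.IsPartition) (k : Fin n) :
    R'.partNodes k ⊆ R'.net.nodes := by
  intro v hv
  rcases (h.mem_partNodes k v).1 hv with hv | ⟨-, rfl⟩ | ⟨-, rfl⟩
  · exact h.step.mem_nodes_iff.2 (.inr (.inr (.inr ⟨hR.partNodes_subset k hv,
      ne_of_mem_of_not_mem hv (h.cut₁.2.1 k), ne_of_mem_of_not_mem hv (h.cut₂.2.1 k)⟩)))
  · exact h.step.t_mem
  · exact h.step.p_mem

theorem isCutBetween_c_iff (h : R.ExpandsBy R' i j X) (hR : R.IsPartition) :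
    R'.IsCutBetween X.c k l ↔ (k = i ∧ l = j) ∨ (k = j ∧ l = i) := by
  rw [isCutBetween_iff h.isProofNet.typed (h.partNodes_subset hR), and_iff_right h.step.c_mem,
    and_iff_right fun _ => h.c_notMem_partNodes hR, and_iff_right h.step.c_label]
  constructor
  · rintro ⟨x, y, hprems, hx, hy⟩
    have hperm := List.perm_pair.1 (h.step.c_prems.symm.trans hprems)
    simp only [List.cons.injEq, and_true] at hperm
    obtain ⟨rfl, rfl⟩ | ⟨rfl, rfl⟩ := hperm
    · exact .inl ⟨(h.e_mem_partEdges hR).1 hx, (h.f_mem_partEdges hR).1 hy⟩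
    · exact .inr ⟨(h.f_mem_partEdges hR).1 hx, (h.e_mem_partEdges hR).1 hy⟩
  · rintro (⟨rfl, rfl⟩ | ⟨rfl, rfl⟩)
    · exact ⟨X.e, X.f, h.step.c_prems, (h.e_mem_partEdges hR).2 rfl, (h.f_mem_partEdges hR).2 rfl⟩
    · exact ⟨X.f, X.e, h.step.c_prems.trans (.swap _ _ _), (h.f_mem_partEdges hR).2 rfl,
        (h.e_mem_partEdges hR).2 rfl⟩

theorem isCutBetween_iff_of_mem (h : R.ExpandsBy R' i j X) (hR : R.IsPartition)
    (hv : v ∈ R.net.nodes) (hv₁ : v ≠ X.c₁) (hv₂ : v ≠ X.c₂) :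
    R'.IsCutBetween v k l ↔ R.IsCutBetween v k l := by
  obtain ⟨hlabel, hprems, -⟩ := h.step.eq_of_mem hv hv₁ hv₂
  have hv' : v ∈ R'.net.nodes := h.step.mem_nodes_iff.2 (.inr (.inr (.inr ⟨hv, hv₁, hv₂⟩)))
  have hedge : ∀ {x y : ε}, (R.net.prems v).Perm [x, y] → x ∈ R.net.edges ∧ y ∈ R.net.edges :=
    fun hperm => ⟨hR.isProofNet.typed.prems_mem v hv _ (hperm.mem_iff.2 (by simp)),
      hR.isProofNet.typed.prems_mem v hv _ (hperm.mem_iff.2 (by simp))⟩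
  rw [isCutBetween_iff h.isProofNet.typed (h.partNodes_subset hR),
    isCutBetween_iff hR.isProofNet.typed hR.partNodes_subset, hlabel, hprems]
  refine and_congr (iff_of_true hv' hv)
    (and_congr (forall_congr' fun _ => not_congr (h.mem_partNodes_iff_of_mem hv))
      (and_congr_right fun _ => exists_congr fun x => exists_congr fun y =>
        and_congr_right fun hperm => and_congr ?_ ?_))
  · exact h.mem_partEdges_iff_of_mem (hedge hperm).1
  · exact h.mem_partEdges_iff_of_mem (hedge hperm).2

theorem isCutBetween_iff (h : R.ExpandsBy R' i j X) (hR : R.IsPartition) :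
    R'.IsCutBetween v k l ↔ (v = X.c ∧ ((k = i ∧ l = j) ∨ (k = j ∧ l = i))) ∨
      (R.IsCutBetween v k l ∧ v ≠ X.c₁ ∧ v ≠ X.c₂) := by
  constructor
  · intro hv
    rcases h.step.mem_nodes_iff.1 hv.1 with rfl | rfl | rfl | ⟨hvR, hv₁, hv₂⟩
    · exact .inl ⟨rfl, (h.isCutBetween_c_iff hR).1 hv⟩
    · exact absurd ((h.mem_partNodes i _).2 (.inr (.inl ⟨rfl, rfl⟩))) (hv.2.1 i)
    · exact absurd ((h.mem_partNodes j _).2 (.inr (.inr ⟨rfl, rfl⟩))) (hv.2.1 j)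
    · exact .inr ⟨(h.isCutBetween_iff_of_mem hR hvR hv₁ hv₂).1 hv, hv₁, hv₂⟩
  · rintro (⟨rfl, hkl⟩ | ⟨hv, hv₁, hv₂⟩)
    · exact (h.isCutBetween_c_iff hR).2 hkl
    · exact (h.isCutBetween_iff_of_mem hR hv.1 hv₁ hv₂).2 hv

theorem skeleton_eq (h : R.ExpandsBy R' i j X) (hR : R.IsPartition) :
    R'.skeleton = R.skeleton := by
  ext k l
  refine and_congr_right fun _ => ⟨?_, ?_⟩
  · rintro ⟨v, hv⟩
    rcases (h.isCutBetween_iff hR).1 hv with ⟨-, ⟨rfl, rfl⟩ | ⟨rfl, rfl⟩⟩ | ⟨hv, -⟩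
    · exact ⟨_, h.cut₁⟩
    · exact ⟨_, h.cut₁.symm⟩
    · exact ⟨v, hv⟩
  · rintro ⟨v, hv⟩
    by_cases hv₁ : v = X.c₁
    · subst hv₁
      exact ⟨X.c, (h.isCutBetween_c_iff hR).2 (hR.eq_of_isCutBetween h.cut₁ hv)⟩
    by_cases hv₂ : v = X.c₂
    · subst hv₂
      exact ⟨X.c, (h.isCutBetween_c_iff hR).2 (hR.eq_of_isCutBetween h.cut₂ hv)⟩
    exact ⟨v, (h.isCutBetween_iff hR).2 (.inr ⟨hv, hv₁, hv₂⟩)⟩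

theorem eq_of_mem_partNodes (h : R.ExpandsBy R' i j X) (hR : R.IsPartition)
    (hv : v ∈ R.partNodes k) :
    R'.net.prems v = R.net.prems v ∧ R'.net.concls v = R.net.concls v :=
  (h.step.eq_of_mem (hR.partNodes_subset k hv) (ne_of_mem_of_not_mem hv (h.cut₁.2.1 k))
    (ne_of_mem_of_not_mem hv (h.cut₂.2.1 k))).2

theorem part_isProofNet (h : R.ExpandsBy R' i j X) (hR : R.IsPartition) (k : Fin n) :
    (R'.part k).IsProofNet := by
  have hpart := hR.part_isProofNet k
  refine h.isProofNet.restrict (h.partNodes_subset hR k) ?_ ?_ ?_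
  · intro v hv x hx
    rw [h.mem_partEdges]
    left
    rcases (h.mem_partNodes k v).1 hv with hv | ⟨rfl, rfl⟩ | ⟨rfl, rfl⟩
    · exact hpart.typed.prems_mem v hv x ((h.eq_of_mem_partNodes hR hv).1 ▸ hx)
    · rw [h.step.t_prems, List.mem_pair] at hx
      exact hx.elim (· ▸ h.a_mem) (· ▸ h.b_mem)
    · rw [h.step.p_prems, List.mem_pair] at hx
      exact hx.elim (· ▸ h.a'_mem) (· ▸ h.b'_mem)
  · intro v hv x hx
    rw [h.mem_partEdges]
    rcases (h.mem_partNodes k v).1 hv with hv | ⟨rfl, rfl⟩ | ⟨rfl, rfl⟩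
    · exact .inl (hpart.typed.concls_mem v hv x ((h.eq_of_mem_partNodes hR hv).2 ▸ hx))
    · exact .inr (.inl ⟨rfl, by simpa [h.step.t_concls] using hx⟩)
    · exact .inr (.inr ⟨rfl, by simpa [h.step.p_concls] using hx⟩)
  · intro x hx
    rcases (h.mem_partEdges k x).1 hx with hx | ⟨rfl, rfl⟩ | ⟨rfl, rfl⟩
    · obtain ⟨v, hv, hxv⟩ := hpart.edge_is_concl x hx
      exact ⟨v, (h.mem_partNodes k v).2 (.inl hv), (h.eq_of_mem_partNodes hR hv).2 ▸ hxv⟩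
    · exact ⟨X.t, (h.mem_partNodes k _).2 (.inr (.inl ⟨rfl, rfl⟩)), by simp [h.step.t_concls]⟩
    · exact ⟨X.p, (h.mem_partNodes k _).2 (.inr (.inr ⟨rfl, rfl⟩)), by simp [h.step.p_concls]⟩

theorem partNodes_disjoint (h : R.ExpandsBy R' i j X) (hR : R.IsPartition) (hkl : k ≠ l) :
    Disjoint (R'.partNodes k) (R'.partNodes l) := by
  refine Finset.disjoint_left.2 fun v hk hl => ?_
  have hdisj : v ∈ R.partNodes k → v ∉ R.partNodes l :=
    fun hv => Finset.disjoint_left.1 (hR.partNodes_disjoint k l hkl) hv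
  have hk' := fun hv : v ∈ R.partNodes k => h.step.ne_of_mem (hR.partNodes_subset k hv)
  have hl' := fun hv : v ∈ R.partNodes l => h.step.ne_of_mem (hR.partNodes_subset l hv)
  have htp := h.step.nodes_distinct.2.2
  rw [h.mem_partNodes] at hk hl
  grind

theorem partEdges_disjoint (h : R.ExpandsBy R' i j X) (hR : R.IsPartition) (hkl : k ≠ l) :
    Disjoint (R'.partEdges k) (R'.partEdges l) := by
  refine Finset.disjoint_left.2 fun x hk hl => ?_
  have hdisj : x ∈ R.partEdges k → x ∉ R.partEdges l :=
    fun hx => Finset.disjoint_left.1 (hR.partEdges_disjoint k l hkl) hx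
  have hk' := fun hx => (h.step.mem_edges x).1 (hR.partEdges_subset k hx)
  have hl' := fun hx => (h.step.mem_edges x).1 (hR.partEdges_subset l hx)
  have hef := h.e_ne_f
  rw [h.mem_partEdges] at hk hl
  grind

theorem isPartition (h : R.ExpandsBy R' i j X) (hR : R.IsPartition) : R'.IsPartition where
  isProofNet := h.isProofNet
  partNodes_subset := h.partNodes_subset hR
  partEdges_subset k x hx := by
    rcases (h.mem_partEdges k x).1 hx with hx | ⟨-, rfl⟩ | ⟨-, rfl⟩
    · exact ((h.step.mem_edges x).1 (hR.partEdges_subset k hx)).1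
    · exact h.isProofNet.typed.concls_mem _ h.step.t_mem _ (by simp [h.step.t_concls])
    · exact h.isProofNet.typed.concls_mem _ h.step.p_mem _ (by simp [h.step.p_concls])
  part_isProofNet := h.part_isProofNet hR
  partNodes_disjoint _ _ := h.partNodes_disjoint hR
  partEdges_disjoint _ _ := h.partEdges_disjoint hR
  edges_covered x hx := by
    by_cases hxe : x = X.e
    · exact ⟨i, hxe ▸ (h.e_mem_partEdges hR).2 rfl⟩
    by_cases hxf : x = X.f
    · exact ⟨j, hxf ▸ (h.f_mem_partEdges hR).2 rfl⟩
    have hxR := (h.step.mem_edges x).2 ⟨hx, hxe, hxf⟩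
    obtain ⟨k, hk⟩ := hR.edges_covered x hxR
    exact ⟨k, (h.mem_partEdges_iff_of_mem hxR).2 hk⟩
  nodes_covered v hv := by
    rcases h.step.mem_nodes_iff.1 hv with rfl | rfl | rfl | ⟨hvR, hv₁, hv₂⟩
    · exact .inr ⟨i, j, h.ne, (h.isCutBetween_c_iff hR).2 (.inl ⟨rfl, rfl⟩)⟩
    · exact .inl ⟨i, (h.mem_partNodes i _).2 (.inr (.inl ⟨rfl, rfl⟩))⟩
    · exact .inl ⟨j, (h.mem_partNodes j _).2 (.inr (.inr ⟨rfl, rfl⟩))⟩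
    · rcases hR.nodes_covered v hvR with ⟨k, hk⟩ | ⟨k, l, hkl, hcut⟩
      · exact .inl ⟨k, (h.mem_partNodes_iff_of_mem hvR).2 hk⟩
      · exact .inr ⟨k, l, hkl, (h.isCutBetween_iff_of_mem hR hvR hv₁ hv₂).2 hcut⟩

end ExpandsBy

/-- The partition in which a new node `t` and a new edge `e` join the `i`-th part, and `p` and `f`
the `j`-th one. -/
noncomputable def extend (R : PartitionedNet α ν ε n) (M : NetGraph α ν ε) (i j : Fin n)
    (t p : ν) (e f : ε) : PartitionedNet α ν ε n :=
  open Classical in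
  { net := M
    partNodes k := R.partNodes k ∪ (({t, p} : Finset ν).filter fun v =>
      (k = i ∧ v = t) ∨ (k = j ∧ v = p))
    partEdges k := R.partEdges k ∪ (({e, f} : Finset ε).filter fun x =>
      (k = i ∧ x = e) ∨ (k = j ∧ x = f)) }

/-- The parts connected to that of the edge `x` in the skeleton once the adjacency of `i` and `j` is
removed. When this adjacency is a bridge, it tells on which side of the bridge `x` lies. -/
def side (R : PartitionedNet α ν ε n) (i j : Fin n) (x : ε) : Set (Fin n) :=
  {m | ∃ k, x ∈ R.partEdges k ∧ (R.skeleton.deleteEdges {s(i, j)}).Reachable k m}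

namespace IsPartition

theorem exists_expandsBy [Infinite ν] [Infinite ε] (hR : R.IsPartition) (hij : i ≠ j) {c₁ c₂ : ν}
    (hc : c₁ ≠ c₂) (hcut₁ : R.IsCutBetween c₁ i j) (hcut₂ : R.IsCutBetween c₂ i j)
    (havoid : ∀ l, IsPath hR.isProofNet.typed.toGraph c₁ l c₂ → CuspFree R.net.portColor l →
      ∀ d ∈ l, d.edge ∉ R.partEdges i) :
    ∃ R' X, R.ExpandsBy R' i j X := by
  obtain ⟨hc₁, -, hlabel₁, a, a', hprems₁, ha, ha'⟩ := id hcut₁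
  obtain ⟨hc₂, -, hlabel₂, b, b', hprems₂, hb, hb'⟩ := id hcut₂
  obtain ⟨M, c, t, p, e, f, hM, hstep⟩ := hR.isProofNet.typed.exists_tensorParStep hc₁ hc₂ hc
    hlabel₁ hlabel₂ hprems₁ hprems₂
  have hnet : M.IsProofNet := hstep.isProofNet hM hR.isProofNet fun l hl hcusp d hd =>
    ⟨(ne_of_mem_of_not_mem ha.1 (havoid l hl hcusp d hd)).symm,
      (ne_of_mem_of_not_mem hb.1 (havoid l hl hcusp d hd)).symm⟩
  refine ⟨R.extend M i j t p e f, ⟨c, t, p, e, f, a, b, a', b', c₁, c₂⟩, hij, hstep, hnet, hcut₁,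
    hcut₂, ha.1, hb.1, ha'.1, hb'.1, fun k v => ?_, fun k x => ?_⟩
  · simp only [extend, Finset.mem_union, Finset.mem_filter, Finset.mem_insert,
      Finset.mem_singleton]
    tauto
  · simp only [extend, Finset.mem_union, Finset.mem_filter, Finset.mem_insert,
      Finset.mem_singleton]
    tauto

theorem mem_partNodes_or_isCutBetween_of_joins (hR : R.IsPartition) {u w : ν}
    (hx : R.net.Joins x u w) :
    (∃ k, u ∈ R.partNodes k ∧ x ∈ R.partEdges k) ∨
      ∃ k l, k ≠ l ∧ R.IsCutBetween u k l ∧ x ∈ R.partEdges k := by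
  have hinc : x ∈ R.net.concls u ∨ x ∈ R.net.prems u := hx.2.2.imp And.left And.right
  rcases hR.nodes_covered u hx.1 with ⟨k, hu⟩ | ⟨k, l, hkl, hcut⟩
  · have hpart := (hR.part_isProofNet k).typed
    exact .inl ⟨k, hu, hinc.elim (hpart.concls_mem u hu x) (hpart.prems_mem u hu x)⟩
  · obtain ⟨hu, -, hlabel, y, z, hprems, hy, hz⟩ := id hcut
    rw [hR.isProofNet.typed.concls_eq_nil hu hlabel, hprems.mem_iff, List.mem_pair] at hinc
    rcases hinc with hx | rfl | rfl
    · exact absurd hx List.not_mem_nil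
    · exact .inr ⟨k, l, hkl, hcut, hy.1⟩
    · exact .inr ⟨l, k, hkl.symm, hcut.symm, hz.1⟩

theorem side_eq (hR : R.IsPartition) (hx : x ∈ R.partEdges k) :
    R.side i j x = {m | (R.skeleton.deleteEdges {s(i, j)}).Reachable k m} := by
  ext m
  exact ⟨fun ⟨l, hl, hlm⟩ => hR.eq_of_mem_partEdges hl hx ▸ hlm, fun hm => ⟨k, hx, hm⟩⟩

theorem side_eq_of_reachable (hR : R.IsPartition) {y : ε} (hx : x ∈ R.partEdges k)
    (hy : y ∈ R.partEdges l) (hkl : (R.skeleton.deleteEdges {s(i, j)}).Reachable k l) :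
    R.side i j x = R.side i j y := by
  rw [hR.side_eq hx, hR.side_eq hy]
  ext m
  exact ⟨hkl.symm.trans, hkl.trans⟩

theorem side_eq_of_joins (hR : R.IsPartition) {u w w' : ν} {y : ε} (hx : R.net.Joins x u w)
    (hy : R.net.Joins y u w') (hu : ¬ R.IsCutBetween u i j) : R.side i j x = R.side i j y := by
  rcases hR.mem_partNodes_or_isCutBetween_of_joins hx with
      ⟨k, huk, hxk⟩ | ⟨k, l, hkl, hcut, hxk⟩ <;>
    rcases hR.mem_partNodes_or_isCutBetween_of_joins hy with ⟨m, hum, hym⟩ | ⟨m, m', -, hcut', hym⟩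
  · obtain rfl : k = m := by
      by_contra hkm
      exact Finset.disjoint_left.1 (hR.partNodes_disjoint k m hkm) huk hum
    exact hR.side_eq_of_reachable hxk hym .rfl
  · exact absurd huk (hcut'.2.1 k)
  · exact absurd hum (hcut.2.1 m)
  · have hadj : (R.skeleton.deleteEdges {s(i, j)}).Adj k l := by
      refine (SimpleGraph.deleteEdges_adj ..).2 ⟨⟨hkl, u, hcut⟩, fun hkl => hu ?_⟩
      rcases Sym2.eq_iff.1 hkl with ⟨rfl, rfl⟩ | ⟨rfl, rfl⟩
      · exact hcut
      · exact hcut.symm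
    rcases hR.eq_of_isCutBetween hcut hcut' with ⟨rfl, -⟩ | ⟨rfl, -⟩
    · exact hR.side_eq_of_reachable hxk hym .rfl
    · exact hR.side_eq_of_reachable hxk hym hadj.reachable

theorem side_ne (hR : R.IsPartition) {y : ε} (hx : x ∈ R.partEdges i) (hy : y ∈ R.partEdges j)
    (hbridge : R.skeleton.IsBridge s(i, j)) : R.side i j x ≠ R.side i j y := by
  rw [hR.side_eq hx, hR.side_eq hy]
  intro h
  exact SimpleGraph.isBridge_iff.1 hbridge ((Set.ext_iff.1 h j).2 .rfl)

theorem exists_cut_pair (hR : R.IsPartition) (hbridge : R.skeleton.IsBridge s(i, j))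
    (hcuts : {c | R.IsCutBetween c i j}.Nontrivial) :
    ∃ c₁ c₂, c₁ ≠ c₂ ∧ R.IsCutBetween c₁ i j ∧ R.IsCutBetween c₂ i j ∧
      ∃ k ∈ ({i, j} : Set (Fin n)), ∀ l, IsPath hR.isProofNet.typed.toGraph c₁ l c₂ →
        CuspFree R.net.portColor l → ∀ d ∈ l, d.edge ∉ R.partEdges k := by
  have hfin : V(hR.isProofNet.typed.toGraph).Finite := R.net.nodes.finite_toSet
  have hside : ∀ ⦃u w w' x y⦄, R.net.Joins x u w → R.net.Joins y u w' →
      (R.IsCutBetween u i j → R.net.portColor u x = R.net.portColor u y) →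
      R.side i j x = R.side i j y := by
    intro u w w' x y hx hy hcol
    by_cases hu : R.IsCutBetween u i j
    · rcases NetGraph.portColor_eq_iff.1 (hcol hu) with rfl | ⟨hlabel, -⟩
      · rfl
      · simp [hu.2.2.1] at hlabel
    · exact hR.side_eq_of_joins hx hy hu
  obtain ⟨c₁, hc₁, c₂, hc₂, hc, hpaths⟩ :=
    (hR.isProofNet.correct.cuspAcyclic hR.isProofNet.typed).exists_pair hfin
      (hcuts.mono fun c hc => ⟨hc, hc.1⟩) hside
  refine ⟨c₁, c₂, hc, hc₁, hc₂, ?_⟩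
  by_contra! h
  obtain ⟨l, hl, hcusp, d, hd, hdi⟩ := h i (by simp)
  obtain ⟨l', hl', hcusp', d', hd', hdj⟩ := h j (by simp)
  exact hR.side_ne hdi hdj hbridge (hpaths l hl hcusp l' hl' hcusp' d hd d' hd')

theorem exists_expandsBy_of_nontrivial [Infinite ν] [Infinite ε] (hR : R.IsPartition)
    (hac : R.skeleton.IsAcyclic) (hij : i ≠ j) (hcuts : {c | R.IsCutBetween c i j}.Nontrivial) :
    ∃ R' k l X, R.ExpandsBy R' k l X := by
  have hadj : R.skeleton.Adj i j := ⟨hij, hcuts.nonempty⟩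
  obtain ⟨c₁, c₂, hc, hcut₁, hcut₂, k, rfl | rfl, havoid⟩ := hR.exists_cut_pair
    (SimpleGraph.isAcyclic_iff_forall_adj_isBridge.1 hac hadj) hcuts
  · obtain ⟨R', X, h⟩ := hR.exists_expandsBy hij hc hcut₁ hcut₂ havoid
    exact ⟨R', k, j, X, h⟩
  · obtain ⟨R', X, h⟩ := hR.exists_expandsBy hij.symm hc hcut₁.symm hcut₂.symm havoid
    exact ⟨R', k, i, X, h⟩

end IsPartition

end PartitionedNet

theorem mainTheorem3_general {α ν ε : Type*} [Infinite ν] [Infinite ε] {n : ℕ}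
    (R : PartitionedNet α ν ε n) (hR : R.IsPartition) (hac : R.skeleton.IsAcyclic) :
    ∃ R' : PartitionedNet α ν ε n,
      Relation.ReflTransGen PartitionedNet.Expands R R' ∧
      R'.IsPartition ∧ R'.skeleton = R.skeleton ∧
      ∀ i j : Fin n, i ≠ j → {c : ν | R'.IsCutBetween c i j}.Subsingleton := by
  induction hm : R.net.cuts.card using Nat.strong_induction_on generalizing R with
  | _ m ih =>
    by_cases hcuts : ∀ i j : Fin n, i ≠ j → {c : ν | R.IsCutBetween c i j}.Subsingleton
    · exact ⟨R, .refl, hR, rfl, hcuts⟩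
    push Not at hcuts
    obtain ⟨i, j, hij, hij'⟩ := hcuts
    obtain ⟨R₁, k, l, X, h⟩ := hR.exists_expandsBy_of_nontrivial hac hij hij'
    have hskel : R₁.skeleton = R.skeleton := h.skeleton_eq hR
    have hlt : R₁.net.cuts.card < m := by
      rw [← hm, h.step.card_cuts]
      exact Nat.lt_succ_self _
    obtain ⟨R', hexp, hR', hskel', hcuts'⟩ := ih _ hlt R₁ (h.isPartition hR) (hskel ▸ hac) rfl
    exact ⟨R', .head ⟨k, l, h.expandsAt hR.isProofNet⟩ hexp, hR', hskel'.trans hskel, hcuts'⟩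

theorem mainTheorem3 {α ν ε : Type*} [Infinite ν] [Infinite ε] {n : ℕ}
    (R : PartitionedNet α ν ε n) (hR : R.IsCutNet) :
    ∃ R' : PartitionedNet α ν ε n,
      Relation.ReflTransGen PartitionedNet.Expands R R' ∧
      R'.IsCutNet ∧
      ∀ i j : Fin n, i ≠ j → {c : ν | R'.IsCutBetween c i j}.Subsingleton := by
  obtain ⟨R', hexp, hR', hskel, hcuts⟩ :=
    mainTheorem3_general R hR.isPartition hR.skeleton_isTree.isAcyclic
  exact ⟨R', hexp, ⟨hR', hskel ▸ hR.skeleton_isTree⟩, hcuts⟩
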